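/- Let $p=(p_1,p_2,\dots)$ be formal variables. For a partition $\mu=(\mu_1\ge\dots\ge\mu_{l(\mu)}>0)$ of $d=|\mu|$ let $p_\mu=p_{\mu_1}\cdots p_{\mu_{l(\mu)}}$, let $m_j(\mu)$ be the number of parts equal to $j$, and put $z_\mu=\prod_j m_j(\mu)!\,j^{m_j(\mu)}$ and $\kappa_\mu=|\mu|+\sum_i(\mu_i^2-2i\mu_i)$. Let $\chi_\nu$ be the character of the irreducible representation of $S_d$ indexed by the partition $\nu$ of $d$ (trivial for $\nu=(d)$), and $\chi_\nu(C(\mu))$ its value on permutations of cycle type $\mu$. Put $$V_\nu(\lambda)=\prod_{1\le a<b\le l(\nu)}\frac{\sin[(\nu_a-\nu_b+b-a)\lambda/2]}{\sin[(b-a)\lambda/2]}\cdot\frac{1}{\prod_{i=1}^{l(\nu)}\prod_{v=1}^{\nu_i}2\sin[(v-i+l(\nu))\lambda/2]},$$ $$W_\mu(\lambda;\tau)=\sum_{|\nu|=|\mu|}\frac{\chi_\nu(C(\mu))}{z_\mu}\,e^{\sqrt{-1}(\tau+\frac12)\kappa_\nu\lambda/2}\,V_\nu(\lambda).$$ Define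 formal power series in $p$, depending on $\lambda$ and $\tau$, by $$R(\lambda;\tau;p)=\sum_{n\ge1}\frac{(-1)^{n-1}}{n}\sum_{|\mu|\ge1}\Bigl(\sum_{\mu^1\cup\dots\cup\mu^n=\mu}\ \prod_{i=1}^nW_{\mu^i}(\lambda;\tau)\Bigr)p_\mu,\qquad R^\bullet(\lambda;\tau;p)=\sum_{|\mu|\ge0}W_\mu(\lambda;\tau)\,p_\mu,$$ where the inner sum is over ordered $n$-tuples of nonempty partitions with union $\mu$. Let $\lambda\in\mathbb C$ be such that $\sin(k\lambda/2)\ne0$ for all integers $k\ge1$ (so that all denominators are nonzero), and let $\tau\in\mathbb C$. Then $R^\bullet=\exp R$, the coefficients of $R$ and $R^\bullet$ are differentiable in $\tau$, and (the infinite sums being finite in each coefficient) $$\frac{\partial R}{\partial\tau}=\frac{\sqrt{-1}\lambda}{2}\sum_{i,j\ge1}\Bigl(ij\,p_{i+j}\frac{\partial^2R}{\partial p_i\partial p_j}+ij\,p_{i+j}\frac{\partial R}{\partial p_i}\frac{\partial R}{\partial p_j}+(i+j)p_ip_j\frac{\partial R}{\partial p_{i+j}}\Bigr),$$ $$\frac{\partial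 R^\bullet}{\partial\tau}=\frac{\sqrt{-1}\lambda}{2}\sum_{i,j\ge1}\Bigl(ij\,p_{i+j}\frac{\partial^2R^\bullet}{\partial p_i\partial p_j}+(i+j)p_ip_j\frac{\partial R^\bullet}{\partial p_{i+j}}\Bigr).$$ -/

import Mathlib

noncomputable section

namespace CutJoin

open MvPowerSeries

/-! ### Young diagrams and the irreducible characters of the symmetric groups -/

/-- The rows `ν₁ ≥ ν₂ ≥ ⋯ ≥ ν_l > 0` of a partition `ν` of `d`, in weakly decreasing order.
The entry of the list at position `i` (counted from `0`) is `ν_{i+1}`. -/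
def rows {d : ℕ} (ν : Nat.Partition d) : List ℕ := ν.parts.sort (· ≥ ·)

theorem rows_sortedGE {d : ℕ} (ν : Nat.Partition d) : (rows ν).SortedGE :=
  (Multiset.pairwise_sort _ _).sortedGE

theorem rows_sum {d : ℕ} (ν : Nat.Partition d) : (rows ν).sum = d := by
  have h : ((rows ν : List ℕ) : Multiset ℕ) = ν.parts := Multiset.sort_eq _ _
  rw [← Multiset.sum_coe, h, ν.parts_sum]

/-- The Young diagram of `ν`; the box in row `i` and column `j` is the pair `(i, j)`. -/
def diagram {d : ℕ} (ν : Nat.Partition d) : YoungDiagram :=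
  YoungDiagram.ofRowLens (rows ν) (rows_sortedGE ν)

/-- The type of boxes of the Young diagram of `ν`. -/
abbrev Box {d : ℕ} (ν : Nat.Partition d) : Type := {c : ℕ × ℕ // c ∈ (diagram ν).cells}

theorem card_cellsOfRowLens (w : List ℕ) : (YoungDiagram.cellsOfRowLens w).card = w.sum := by
  induction w with
  | nil => rfl
  | cons a w ih =>
    rw [YoungDiagram.cellsOfRowLens, Finset.card_union_of_disjoint, Finset.card_map, ih]
    · simp
    · rw [Finset.disjoint_left]
      rintro ⟨x, y⟩ h1 h2
      simp at h1 h2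
      omega

theorem card_box {d : ℕ} (ν : Nat.Partition d) : Fintype.card (Box ν) = d := by
  rw [Fintype.card_coe]
  exact (card_cellsOfRowLens _).trans (rows_sum ν)

/-- The symmetric group `S_d`, realised as the group of permutations of the `d` boxes of `ν`. -/
abbrev SymGroup {d : ℕ} (ν : Nat.Partition d) : Type := Equiv.Perm (Box ν)

/-- `g` preserves every row of the diagram. -/
def PreservesRows {d : ℕ} (ν : Nat.Partition d) (g : SymGroup ν) : Prop :=
  ∀ c : Box ν, (g c).1.1 = c.1.1

/-- `g` preserves every column of the diagram. -/
def PreservesCols {d : ℕ} (ν : Nat.Partition d) (g : SymGroup ν) : Prop :=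
  ∀ c : Box ν, (g c).1.2 = c.1.2

open Classical in
/-- The row symmetrizer `a_ν = ∑_{g preserves rows} g`. -/
def rowSymmetrizer {d : ℕ} (ν : Nat.Partition d) : MonoidAlgebra ℂ (SymGroup ν) :=
  ∑ g : SymGroup ν with PreservesRows ν g, MonoidAlgebra.single g 1

open Classical in
/-- The column antisymmetrizer `b_ν = ∑_{g preserves columns} sgn(g) g`. -/
def colAntisymmetrizer {d : ℕ} (ν : Nat.Partition d) : MonoidAlgebra ℂ (SymGroup ν) :=
  ∑ g : SymGroup ν with PreservesCols ν g,
    MonoidAlgebra.single g (((Equiv.Perm.sign g : ℤˣ) : ℤ) : ℂ)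

/-- The Young symmetrizer `c_ν = a_ν b_ν` in the group algebra `ℂ[S_d]`. -/
def youngSymmetrizer {d : ℕ} (ν : Nat.Partition d) : MonoidAlgebra ℂ (SymGroup ν) :=
  rowSymmetrizer ν * colAntisymmetrizer ν

/-- The Specht module `ℂ[S_d] c_ν` (a left ideal of the group algebra): the irreducible
representation of `S_d` indexed by `ν`.  It is the trivial representation for `ν = (d)` and
the sign representation for `ν = (1, …, 1)`. -/
abbrev SpechtModule {d : ℕ} (ν : Nat.Partition d) : Ideal (MonoidAlgebra ℂ (SymGroup ν)) :=
  Ideal.span {youngSymmetrizer ν}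

/-- The action of `S_d` on the Specht module by left multiplication. -/
def spechtRep {d : ℕ} (ν : Nat.Partition d) :
    Representation ℂ (SymGroup ν) (SpechtModule ν) :=
  ((Algebra.lsmul ℂ ℂ (SpechtModule ν) : MonoidAlgebra ℂ (SymGroup ν) →ₐ[ℂ]
      Module.End ℂ (SpechtModule ν)) : MonoidAlgebra ℂ (SymGroup ν) →*
      Module.End ℂ (SpechtModule ν)).comp (MonoidAlgebra.of ℂ (SymGroup ν))

/-! ### Partitions as multiplicity functions

A partition `μ` that indexes a monomial `p_μ` is given by its multiplicities
`i ↦ m_i(μ)`, a finitely supported function on the positive integers.  The union of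
partitions is then the sum of functions, and `p_μ = ∏ p_i ^ m_i(μ)` is the monomial with
exponent `μ`. -/

/-- The size `|μ| = ∑_i i m_i(μ)`. -/
def size (μ : ℕ+ →₀ ℕ) : ℕ := μ.sum fun i k => k * (i : ℕ)

/-- The number of parts `l(μ) = ∑_i m_i(μ)`. -/
def length (μ : ℕ+ →₀ ℕ) : ℕ := μ.sum fun _ k => k

/-- `z_μ = ∏_j m_j(μ)! j ^ m_j(μ)`. -/
def zee (μ : ℕ+ →₀ ℕ) : ℕ := μ.prod fun j k => k.factorial * (j : ℕ) ^ k

/-- The multiset of parts of `μ`. -/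
def parts (μ : ℕ+ →₀ ℕ) : Multiset ℕ := (Finsupp.toMultiset μ).map fun i : ℕ+ => (i : ℕ)

theorem parts_sum (μ : ℕ+ →₀ ℕ) : (parts μ).sum = size μ := by
  induction μ using Finsupp.induction_linear with
  | zero => simp [parts, size]
  | add f g hf hg =>
    have h : size (f + g) = size f + size g :=
      Finsupp.sum_add_index' (by simp) (by intros; ring)
    rw [h, ← hf, ← hg]
    simp [parts]
  | single i k =>
    simp [parts, size, Finsupp.toMultiset_single, Multiset.map_nsmul, Multiset.sum_nsmul]

theorem parts_pos (μ : ℕ+ →₀ ℕ) {n : ℕ} (h : n ∈ parts μ) : 0 < n := by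
  obtain ⟨i, -, rfl⟩ := Multiset.mem_map.1 h
  exact i.pos

/-- There are permutations of every cycle type (fixed points are parts equal to `1`). -/
theorem exists_cycleType (μ : ℕ+ →₀ ℕ) (ν : Nat.Partition (size μ)) :
    ∃ g : SymGroup ν, g.partition.parts = parts μ := by
  classical
  have hc : Fintype.card (Box ν) = size μ := card_box ν
  obtain ⟨g, hg⟩ := (Equiv.Perm.exists_with_cycleType_iff (α := Box ν)
    (m := (parts μ).filter (2 ≤ ·))).2 ⟨by
      rw [hc, ← parts_sum]
      obtain ⟨u, hu⟩ := Multiset.le_iff_exists_add.1 (Multiset.filter_le (2 ≤ ·) (parts μ))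
      conv_rhs => rw [hu]
      rw [Multiset.sum_add]
      exact Nat.le_add_right _ _, fun a ha => (Multiset.mem_filter.1 ha).2⟩
  refine ⟨g, ?_⟩
  have h1 : (parts μ).filter (fun n => ¬ 2 ≤ n) =
      Multiset.replicate ((parts μ).filter (fun n => ¬ 2 ≤ n)).card 1 := by
    rw [Multiset.eq_replicate_card]
    intro b hb
    rw [Multiset.mem_filter] at hb
    have := parts_pos μ hb.1
    omega
  have h2 := Multiset.filter_add_not (fun n => 2 ≤ n) (parts μ)
  have h3 := congrArg Multiset.sum h2
  rw [Multiset.sum_add, h1, Multiset.sum_replicate, parts_sum, ← hg,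
    Equiv.Perm.sum_cycleType] at h3
  rw [Equiv.Perm.parts_partition, hg]
  conv_rhs => rw [← h2, h1]
  congr 2
  rw [hc]
  simp at h3 ⊢
  omega

/-- The value `χ_ν(C(μ))` of the irreducible character `χ_ν` of `S_d`, `d = |μ| = |ν|`, on the
conjugacy class `C(μ)` of permutations of cycle type `μ`. -/
def chi (μ : ℕ+ →₀ ℕ) (ν : Nat.Partition (size μ)) : ℂ :=
  (spechtRep ν).character (exists_cycleType μ ν).choose

/-! ### The series `R` and `R^•` -/

/-- `κ_ν = |ν| + ∑_i (ν_i² - 2 i ν_i)`, with `i` running from `1` to `l(ν)`. -/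
def kappa {d : ℕ} (ν : Nat.Partition d) : ℤ :=
  (d : ℤ) + ∑ i : Fin (rows ν).length,
    (((rows ν)[i] : ℤ) ^ 2 - 2 * ((i : ℤ) + 1) * ((rows ν)[i] : ℤ))

/-- The function `V_ν(λ)`: the product over rows `a < b` of
`sin[(ν_a - ν_b + b - a)λ/2] / sin[(b - a)λ/2]`, times the inverse of the product over rows
`1 ≤ i ≤ l(ν)` and `1 ≤ v ≤ ν_i` of `2 sin[(v - i + l(ν))λ/2]`. -/
def V {d : ℕ} (ν : Nat.Partition d) (lam : ℂ) : ℂ :=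
  (∏ a : Fin (rows ν).length, ∏ b : Fin (rows ν).length with a < b,
    Complex.sin ((((rows ν)[a] : ℂ) - ((rows ν)[b] : ℂ) + (b : ℕ) - (a : ℕ)) * lam / 2) /
      Complex.sin ((((b : ℕ) : ℂ) - ((a : ℕ) : ℂ)) * lam / 2)) *
  (∏ i : Fin (rows ν).length, ∏ v ∈ Finset.Icc 1 ((rows ν)[i]),
    2 * Complex.sin (((v : ℂ) - (((i : ℕ) : ℂ) + 1) + ((rows ν).length : ℂ)) * lam / 2))⁻¹

/-- `∑_{|ν| = |μ|} χ_ν(C(μ)) / z_μ * exp(√-1 (τ + 1/2) κ_ν λ / 2) V_ν(λ)`. -/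
def weight (lam tau : ℂ) (μ : ℕ+ →₀ ℕ) : ℂ :=
  ∑ ν : Nat.Partition (size μ), chi μ ν / (zee μ : ℂ) *
    Complex.exp (Complex.I * (tau + 1 / 2) * (kappa ν : ℂ) * lam / 2) * V ν lam

/-- The series `R^•(λ; τ; p)`, a formal power series in `p₁, p₂, …`. -/
def RBullet (lam tau : ℂ) : MvPowerSeries ℕ+ ℂ := fun μ => weight lam tau μ

/-- The ordered `n`-tuples `(μ¹, …, μⁿ)` of nonempty partitions with union `μ`. -/
def decompositions (n : ℕ) (μ : ℕ+ →₀ ℕ) : Finset (Fin n → (ℕ+ →₀ ℕ)) :=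
  (Finset.piAntidiag Finset.univ μ).filter fun t => ∀ i, t i ≠ 0

/-- The series `R(λ; τ; p)`: the coefficient of `p_μ` is
`∑_{n ≥ 1} (-1)^(n-1)/n ∑_{μ¹ ∪ ⋯ ∪ μⁿ = μ} ∏_i weight(μⁱ)`.
A union of more than `l(μ)` nonempty partitions has more than `l(μ)` parts, so that only
`n ≤ l(μ)` contribute. -/
def R (lam tau : ℂ) : MvPowerSeries ℕ+ ℂ := fun μ =>
  ∑ n ∈ Finset.Icc 1 (length μ), (-1 : ℂ) ^ (n - 1) / (n : ℂ) *
    ∑ t ∈ decompositions n μ, ∏ i : Fin n, weight lam tau (t i)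

/-! ### Formal operations -/

/-- `S` is the sum of the family `f` of formal power series: every coefficient is nonzero in only
finitely many members of the family, and the coefficients of `S` are the (finite) sums. -/
def HasFormalSum {ι : Type} (f : ι → MvPowerSeries ℕ+ ℂ) (S : MvPowerSeries ℕ+ ℂ) : Prop :=
  ∀ μ : ℕ+ →₀ ℕ, (Function.support fun i => coeff μ (f i)).Finite ∧
    coeff μ S = ∑ᶠ i, coeff μ (f i)

/-- The family `F` of formal power series is differentiable at `tau` in its parameter, with
derivative `F'`: so are all coefficients. -/
def HasParamDerivAt (F : ℂ → MvPowerSeries ℕ+ ℂ) (F' : MvPowerSeries ℕ+ ℂ) (tau : ℂ) : Prop :=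
  ∀ μ : ℕ+ →₀ ℕ, HasDerivAt (fun t => coeff μ (F t)) (coeff μ F') tau

/-- The variable `p_i`. -/
abbrev p (i : ℕ+) : MvPowerSeries ℕ+ ℂ := X i

/-- The formal partial derivative `∂/∂p_i`. -/
abbrev D (i : ℕ+) (F : MvPowerSeries ℕ+ ℂ) : MvPowerSeries ℕ+ ℂ := pderiv ℂ i F

/-- The scalar `n`, as a constant power series. -/
abbrev nat (n : ℕ) : MvPowerSeries ℕ+ ℂ := C (n : ℂ)

end CutJoin

end

/-! Differentiating `RBullet` in τ multiplies the term of shape ν by √-1 λ/2 · κ_ν, and `V` is a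
factor free of τ. The linear equation therefore says that the Frobenius characteristic ∑_μ
χ_ν(C(μ))/z_μ p_μ is an eigenvector of the cut-and-join operator with eigenvalue κ_ν
(`finsum_coeff_cutJoin_frobenius`).

Two facts give this. Multiplying a permutation by a transposition cuts one cycle or joins two. Hence
the operator sends the monomial of the cycle type of g to the sum, over ordered pairs x ≠ y, of the
monomials of (x y)g (`sum_swap_mul`, `finsum_coeff_cutJoin_monomial`). On the other side, the sum of
all transpositions is central and acts on the Specht module by a scalar. Taken over ordered pairs,
this scalar is twice the sum of the contents, which is κ_ν (`swapSum_mul_youngSymmetrizer`,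
`kappa_eq`). Substituting (x y)g for g in the average of χ_ν(g) times the monomial of g transfers
the scalar to the operator.

The series `R` is the logarithm of `RBullet`, whose constant term is 1 (`isLog_R`, `weight_zero`).
Every derivation ∂ satisfies ∂ log F = F⁻¹ ∂F, so the nonlinear equation is the linear one divided
by `RBullet`; the second derivative of the logarithm produces the quadratic term
(`IsLog.inv_mul_cutJoin`). -/

namespace CutJoin

open MvPowerSeries

/-! ### Logarithms of formal power series -/

theorem length_eq_degree (μ : ℕ+ →₀ ℕ) : length μ = μ.degree := rfl

theorem length_add (μ ν : ℕ+ →₀ ℕ) : length (μ + ν) = length μ + length ν := by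
  simp [length_eq_degree]

theorem length_single (i : ℕ+) (k : ℕ) : length (Finsupp.single i k) = k := by
  simp [length]

theorem length_mono {μ ν : ℕ+ →₀ ℕ} (h : μ ≤ ν) : length μ ≤ length ν := by
  obtain ⟨ρ, rfl⟩ := exists_add_of_le h
  rw [length_add]
  exact Nat.le_add_right _ _

/-- The truncation at order `N` of the logarithm of `F`. -/
noncomputable def logTrunc (N : ℕ) (F : MvPowerSeries ℕ+ ℂ) : MvPowerSeries ℕ+ ℂ :=
  ∑ n ∈ Finset.Icc 1 N, C ((-1 : ℂ) ^ (n - 1) / (n : ℂ)) * (F - 1) ^ n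

/-- `G` is the logarithm of `F`. -/
def IsLog (G F : MvPowerSeries ℕ+ ℂ) : Prop :=
  ∀ μ N, length μ ≤ N → coeff μ G = coeff μ (logTrunc N F)

theorem coeff_pow_eq_zero {F : MvPowerSeries ℕ+ ℂ} (hF : constantCoeff F = 0) {μ : ℕ+ →₀ ℕ}
    {n : ℕ} (h : length μ < n) : coeff μ (F ^ n) = 0 :=
  coeff_eq_zero_of_constantCoeff_nilpotent (m := 1) (by simpa using hF)
    (by rw [length_eq_degree] at h; omega)

theorem coeff_mul_pow_eq_zero {F : MvPowerSeries ℕ+ ℂ} (hF : constantCoeff F = 0)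
    (G : MvPowerSeries ℕ+ ℂ) {μ : ℕ+ →₀ ℕ}
    {n : ℕ} (h : length μ < n) : coeff μ (G * F ^ n) = 0 := by
  classical
  rw [coeff_mul]
  refine Finset.sum_eq_zero fun x hx => ?_
  rw [coeff_pow_eq_zero hF, mul_zero]
  refine (length_mono ?_).trans_lt h
  rw [← Finset.HasAntidiagonal.mem_antidiagonal.1 hx]
  exact le_add_self

theorem coeff_mul_congr (G : MvPowerSeries ℕ+ ℂ) {A B : MvPowerSeries ℕ+ ℂ} {μ : ℕ+ →₀ ℕ}
    (h : ∀ ν ≤ μ, coeff ν A = coeff ν B) : coeff μ (G * A) = coeff μ (G * B) := by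
  classical
  rw [coeff_mul, coeff_mul]
  refine Finset.sum_congr rfl fun x hx => ?_
  rw [h]
  rw [← Finset.HasAntidiagonal.mem_antidiagonal.1 hx]
  exact le_add_self

theorem mul_geom_sum_neg (X : MvPowerSeries ℕ+ ℂ) (N : ℕ) :
    (1 + X) * ∑ n ∈ Finset.Icc 1 N, (-X) ^ (n - 1) = 1 - (-X) ^ N := by
  induction N with
  | zero => simp
  | succ N ih =>
    rw [Finset.sum_Icc_succ_top (by omega), mul_add, ih]
    simp only [Nat.add_sub_cancel]
    ring

/-- The derivative of a truncated logarithm, `Y` being the derivative of `F`. -/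
theorem sum_deriv_logTrunc (F Y : MvPowerSeries ℕ+ ℂ) (hF : constantCoeff F = 1) (N : ℕ) :
    ∑ n ∈ Finset.Icc 1 N, C ((-1 : ℂ) ^ (n - 1) / (n : ℂ)) * ((n : MvPowerSeries ℕ+ ℂ) * (F - 1) ^ (n - 1) * Y) =
      F⁻¹ * Y - F⁻¹ * Y * (-1) ^ N * (F - 1) ^ N := by
  have hF' : constantCoeff F ≠ 0 := by rw [hF]; exact one_ne_zero
  have h1 : ∑ n ∈ Finset.Icc 1 N, C ((-1 : ℂ) ^ (n - 1) / (n : ℂ)) * ((n : MvPowerSeries ℕ+ ℂ) * (F - 1) ^ (n - 1) * Y)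
      = (∑ n ∈ Finset.Icc 1 N, (-(F - 1)) ^ (n - 1)) * Y := by
    rw [Finset.sum_mul]
    refine Finset.sum_congr rfl fun n hn => ?_
    have hn0 : (n : ℂ) ≠ 0 := by
      have := (Finset.mem_Icc.1 hn).1
      exact_mod_cast (by omega : n ≠ 0)
    have h2 : (n : MvPowerSeries ℕ+ ℂ) = C (n : ℂ) := (map_natCast C n).symm
    rw [h2, neg_pow (F - 1)]
    have h3 : (C ((-1 : ℂ) ^ (n - 1) / (n : ℂ)) : MvPowerSeries ℕ+ ℂ) * C (n : ℂ) =
        (-1) ^ (n - 1) := by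
      rw [← map_mul, div_mul_cancel₀ _ hn0]
      simp
    linear_combination (F - 1) ^ (n - 1) * Y * h3
  -- The sum is Y times the truncated geometric series of F⁻¹ in powers of 1 - F; the remainder of
  -- that series is the last term of the claim.
  have h4 := mul_geom_sum_neg (F - 1) N
  rw [h1]
  have h5 := F.inv_mul_cancel hF'
  have h6 : (-(F - 1)) ^ N = (-1) ^ N * (F - 1) ^ N := neg_pow _ _
  rw [h6] at h4
  set S := ∑ n ∈ Finset.Icc 1 N, (-(F - 1)) ^ (n - 1)
  linear_combination F⁻¹ * Y * h4 - S * Y * h5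

theorem constantCoeff_sub_one {F : MvPowerSeries ℕ+ ℂ} (hF : constantCoeff F = 1) :
    constantCoeff (F - 1) = 0 := by simp [hF]

/-- The coefficient of a derivative at μ comes from one with one more part, so the truncation at
`length μ + 1` suffices. The remainder then contains (F - 1) to that power and has no coefficient at
μ. -/
theorem IsLog.pderiv_eq {G F : MvPowerSeries ℕ+ ℂ} (h : IsLog G F) (hF : constantCoeff F = 1)
    (i : ℕ+) : pderiv ℂ i G = F⁻¹ * pderiv ℂ i F := by
  ext μ
  have h1 : coeff μ (pderiv ℂ i G) = coeff μ (pderiv ℂ i (logTrunc (length μ + 1) F)) := by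
    rw [coeff_pderiv, coeff_pderiv, h _ (length μ + 1)]
    rw [length_add, length_single]
  have h2 : pderiv ℂ i (logTrunc (length μ + 1) F) =
      ∑ n ∈ Finset.Icc 1 (length μ + 1), C ((-1 : ℂ) ^ (n - 1) / (n : ℂ)) *
        ((n : MvPowerSeries ℕ+ ℂ) * (F - 1) ^ (n - 1) * pderiv ℂ i F) := by
    rw [logTrunc, map_sum]
    refine Finset.sum_congr rfl fun n _ => ?_
    rw [Derivation.leibniz, pderiv_C, pderiv_pow, map_sub, pderiv_one]
    simp
  rw [h1, h2, sum_deriv_logTrunc _ _ hF, map_sub,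
    coeff_mul_pow_eq_zero (constantCoeff_sub_one hF) _ (Nat.lt_succ_self _), sub_zero]

theorem IsLog.constantCoeff_eq {G F : MvPowerSeries ℕ+ ℂ} (h : IsLog G F) :
    constantCoeff G = 0 := by
  have := h 0 0 (by simp [length])
  rw [coeff_zero_eq_constantCoeff_apply] at this
  simpa [logTrunc] using this

/-- The exponential E of G and the series F both solve ∂_i Y = ∂_i G · Y for every i. So E F⁻¹ has
zero derivatives, and its constant term is 1. -/
theorem IsLog.hasFormalSum_exp {G F : MvPowerSeries ℕ+ ℂ} (h : IsLog G F)
    (hF : constantCoeff F = 1) :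
    HasFormalSum (fun n : ℕ => C ((n.factorial : ℂ)⁻¹) * G ^ n) F := by
  have hG := h.constantCoeff_eq
  have hF' : constantCoeff F ≠ 0 := by rw [hF]; exact one_ne_zero
  set T : ℕ → MvPowerSeries ℕ+ ℂ := fun N =>
    ∑ n ∈ Finset.range N, C ((n.factorial : ℂ)⁻¹) * G ^ n with hT
  have hterm : ∀ μ n, length μ < n → coeff μ (C ((n.factorial : ℂ)⁻¹) * G ^ n) = 0 :=
    fun μ n hn => coeff_mul_pow_eq_zero hG _ hn
  have hTN : ∀ μ N, length μ < N → coeff μ (T N) = coeff μ (T (length μ + 1)) := by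
    intro μ N hN
    rw [hT]
    simp only [map_sum]
    symm
    refine Finset.sum_subset (Finset.range_subset_range.2 hN) fun n _ hn => hterm μ n ?_
    simp at hn
    omega
  have hdT : ∀ i N, pderiv ℂ i (T (N + 1)) = pderiv ℂ i G * T N := by
    intro i N
    rw [hT]
    simp only
    rw [Finset.sum_range_succ', map_add, map_sum, Finset.mul_sum]
    simp only [pow_zero, mul_one, pderiv_C, add_zero]
    refine Finset.sum_congr rfl fun n _ => ?_
    rw [Derivation.leibniz, pderiv_C, pderiv_pow, Nat.add_sub_cancel]
    have h2 : ((n + 1 : ℕ) : MvPowerSeries ℕ+ ℂ) = C ((n + 1 : ℕ) : ℂ) :=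
      (map_natCast C (n + 1)).symm
    have h3 : (C (((n + 1).factorial : ℂ)⁻¹) : MvPowerSeries ℕ+ ℂ) * C ((n + 1 : ℕ) : ℂ) =
        C ((n.factorial : ℂ)⁻¹) := by
      rw [← map_mul]
      congr 1
      have : ((n + 1 : ℕ) : ℂ) ≠ 0 := by exact_mod_cast Nat.succ_ne_zero n
      rw [Nat.factorial_succ, Nat.cast_mul, mul_inv]
      field_simp
    rw [h2, smul_eq_mul, smul_zero, add_zero]
    linear_combination G ^ n * pderiv ℂ i G * h3
  -- As G has no constant term, only the powers n ≤ `length μ` reach the coefficient at μ.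
  let E : MvPowerSeries ℕ+ ℂ := fun μ => coeff μ (T (length μ + 1))
  have hE : ∀ μ, coeff μ E = coeff μ (T (length μ + 1)) := fun μ => rfl
  have hdE : ∀ i, pderiv ℂ i E = pderiv ℂ i G * E := by
    intro i
    ext μ
    rw [coeff_pderiv, hE, length_add, length_single, ← coeff_pderiv, hdT]
    refine coeff_mul_congr _ fun ν hν => ?_
    rw [hE, hTN ν]
    exact Nat.lt_succ_of_le (length_mono hν)
  have hEF : E * F⁻¹ = 1 := by
    refine pderiv.ext (fun i => ?_) ?_
    · rw [Derivation.leibniz, pderiv_inv', hdE, h.pderiv_eq hF, pderiv_one]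
      simp only [smul_eq_mul]
      ring
    · have : constantCoeff E = 1 := by
        rw [← coeff_zero_eq_constantCoeff_apply, hE]
        simp [hT, length]
      rw [map_mul, this, constantCoeff_inv, hF]
      simp
  have hEF' : E = F := by
    have := F.mul_inv_cancel hF'
    linear_combination F * hEF - E * this
  intro μ
  have hsupp : (Function.support fun n : ℕ => coeff μ (C ((n.factorial : ℂ)⁻¹) * G ^ n)) ⊆
      (Finset.range (length μ + 1) : Set ℕ) := by
    intro n hn
    simp only [Finset.coe_range, Set.mem_Iio]
    by_contra hlt
    exact hn (hterm μ n (by omega))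
  refine ⟨(Finset.finite_toSet _).subset hsupp, ?_⟩
  rw [finsum_eq_sum_of_support_subset _ hsupp, ← hEF', hE, hT]
  simp only [map_sum]

/-! ### Differentiation in a parameter -/

theorem HasParamDerivAt.mul {F G : ℂ → MvPowerSeries ℕ+ ℂ} {F' G' : MvPowerSeries ℕ+ ℂ} {t : ℂ}
    (hF : HasParamDerivAt F F' t) (hG : HasParamDerivAt G G' t) :
    HasParamDerivAt (fun s => F s * G s) (F' * G t + F t * G') t := by
  classical
  intro μ
  simp only [coeff_mul, map_add]
  rw [← Finset.sum_add_distrib]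
  exact HasDerivAt.fun_sum fun x _ => (hF x.1).mul (hG x.2)

theorem hasParamDerivAt_const (F : MvPowerSeries ℕ+ ℂ) (t : ℂ) :
    HasParamDerivAt (fun _ => F) 0 t := fun μ => by
  simpa using hasDerivAt_const t (coeff μ F)

theorem HasParamDerivAt.sub_const {F : ℂ → MvPowerSeries ℕ+ ℂ} {F' : MvPowerSeries ℕ+ ℂ} {t : ℂ}
    (hF : HasParamDerivAt F F' t) (G : MvPowerSeries ℕ+ ℂ) :
    HasParamDerivAt (fun s => F s - G) F' t := fun μ => by
  simpa using (hF μ).sub_const (coeff μ G)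

theorem HasParamDerivAt.const_mul {F : ℂ → MvPowerSeries ℕ+ ℂ} {F' : MvPowerSeries ℕ+ ℂ} {t : ℂ}
    (hF : HasParamDerivAt F F' t) (G : MvPowerSeries ℕ+ ℂ) :
    HasParamDerivAt (fun s => G * F s) (G * F') t := by
  simpa using (hasParamDerivAt_const G t).mul hF

theorem HasParamDerivAt.pow {F : ℂ → MvPowerSeries ℕ+ ℂ} {F' : MvPowerSeries ℕ+ ℂ} {t : ℂ}
    (hF : HasParamDerivAt F F' t) (n : ℕ) :
    HasParamDerivAt (fun s => F s ^ n) (n * F t ^ (n - 1) * F') t := by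
  induction n with
  | zero => simpa using hasParamDerivAt_const 1 t
  | succ n ih =>
    have h := ih.mul hF
    simp only [pow_succ]
    convert h using 1
    rcases n with _ | n
    · simp
    · simp only [Nat.add_sub_cancel, Nat.cast_add, Nat.cast_one, pow_succ]
      ring

theorem HasParamDerivAt.sum {ι : Type*} (s : Finset ι) {F : ι → ℂ → MvPowerSeries ℕ+ ℂ}
    {F' : ι → MvPowerSeries ℕ+ ℂ} {t : ℂ} (hF : ∀ i ∈ s, HasParamDerivAt (F i) (F' i) t) :
    HasParamDerivAt (fun x => ∑ i ∈ s, F i x) (∑ i ∈ s, F' i) t := by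
  intro μ
  simp only [map_sum]
  exact HasDerivAt.fun_sum fun i hi => hF i hi μ

/-- The argument is that of `IsLog.pderiv_eq`, with the parameter in place of p_i. Truncating one
order beyond `length μ` makes the remainder of the derivative vanish at μ. -/
theorem IsLog.hasParamDerivAt {G F : ℂ → MvPowerSeries ℕ+ ℂ} {F' : MvPowerSeries ℕ+ ℂ} {t : ℂ}
    (h : ∀ s, IsLog (G s) (F s)) (hF : constantCoeff (F t) = 1)
    (hd : HasParamDerivAt F F' t) : HasParamDerivAt G ((F t)⁻¹ * F') t := by
  intro μ
  have h1 : HasParamDerivAt (fun s => logTrunc (length μ + 1) (F s))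
      (∑ n ∈ Finset.Icc 1 (length μ + 1), C ((-1 : ℂ) ^ (n - 1) / (n : ℂ)) *
        ((n : MvPowerSeries ℕ+ ℂ) * (F t - 1) ^ (n - 1) * F')) t :=
    HasParamDerivAt.sum _ fun n _ => ((hd.sub_const 1).pow n).const_mul _
  rw [sum_deriv_logTrunc _ _ hF] at h1
  have h2 := h1 μ
  rw [map_sub, coeff_mul_pow_eq_zero (constantCoeff_sub_one hF) _ (Nat.lt_succ_self _),
    sub_zero] at h2
  simpa only [h _ μ (length μ + 1) (Nat.le_succ _)] using h2

/-! ### Formal sums -/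

theorem HasFormalSum.const_mul {ι : Type} {f : ι → MvPowerSeries ℕ+ ℂ} {S : MvPowerSeries ℕ+ ℂ}
    (h : HasFormalSum f S) (G : MvPowerSeries ℕ+ ℂ) :
    HasFormalSum (fun i => G * f i) (G * S) := by
  classical
  intro μ
  simp only [coeff_mul]
  have hfin : ∀ x ∈ Finset.HasAntidiagonal.antidiagonal μ,
      (Function.support fun i => coeff x.1 G * coeff x.2 (f i)).Finite := fun x _ =>
    (h x.2).1.subset fun i hi => by
      simp only [Function.mem_support] at hi ⊢
      exact right_ne_zero_of_mul hi
  constructor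
  · refine ((Finset.HasAntidiagonal.antidiagonal μ).finite_toSet.biUnion hfin).subset fun i hi => ?_
    obtain ⟨x, hx, hne⟩ := Finset.exists_ne_zero_of_sum_ne_zero hi
    exact Set.mem_biUnion hx hne
  · rw [finsum_sum_comm _ _ hfin]
    refine Finset.sum_congr rfl fun x _ => ?_
    rw [(h x.2).2, mul_finsum]

theorem HasFormalSum.congr {ι : Type} {f g : ι → MvPowerSeries ℕ+ ℂ} {S : MvPowerSeries ℕ+ ℂ}
    (h : HasFormalSum f S) (hfg : ∀ i, f i = g i) : HasFormalSum g S := by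
  rwa [← funext hfg]

/-- The nonlinear cut-and-join expression of `log F` is the linear one of `F`, divided by `F`. -/
theorem IsLog.inv_mul_cutJoin {G F : MvPowerSeries ℕ+ ℂ} (h : IsLog G F)
    (hF : constantCoeff F = 1) (i j : ℕ+) :
    F⁻¹ * (nat (i * j) * p (i + j) * D i (D j F) + nat (i + j) * p i * p j * D (i + j) F) =
      nat (i * j) * p (i + j) * D i (D j G) + nat (i * j) * p (i + j) * (D i G * D j G) +
        nat (i + j) * p i * p j * D (i + j) G := by
  have hF' : constantCoeff F ≠ 0 := by rw [hF]; exact one_ne_zero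
  simp only [D, h.pderiv_eq hF]
  -- The derivative of F⁻¹ contributes -F⁻² ∂_iF ∂_jF, which cancels the product of the two first
  -- derivatives.
  rw [Derivation.leibniz, pderiv_inv', smul_eq_mul, smul_eq_mul]
  ring

/-- The coefficients of `R` are those of the logarithm of `R^•`. -/
theorem isLog_R (lam tau : ℂ) (h0 : weight lam tau 0 = 1) :
    IsLog (R lam tau) (RBullet lam tau) := by
  classical
  have hc : constantCoeff (RBullet lam tau) = 1 := h0
  have hpow : ∀ (n : ℕ) (μ : ℕ+ →₀ ℕ), coeff μ ((RBullet lam tau - 1) ^ n) =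
      ∑ t ∈ decompositions n μ, ∏ i : Fin n, weight lam tau (t i) := by
    intro n μ
    have hp : (RBullet lam tau - 1) ^ n = ∏ _i : Fin n, (RBullet lam tau - 1) := by simp
    rw [hp, coeff_prod, decompositions, Finset.sum_filter]
    refine Finset.sum_bij' (fun l _ => (l : Fin n → (ℕ+ →₀ ℕ)))
      (fun t _ => Finsupp.equivFunOnFinite.symm t) ?_ ?_ ?_ ?_ ?_
    · intro l hl
      simp only [Finset.mem_finsuppAntidiag, Finset.mem_piAntidiag] at hl ⊢
      exact ⟨hl.1, by simp⟩
    · intro t ht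
      simp only [Finset.mem_finsuppAntidiag, Finset.mem_piAntidiag] at ht ⊢
      exact ⟨ht.1, by simp⟩
    · intro l _
      ext
      simp
    · intro t _
      rfl
    · intro l _
      -- Subtracting 1 removes the constant term, so tuples with an empty partition contribute zero.
      -- This is the condition in `decompositions`.
      have hcoef : ∀ ν : ℕ+ →₀ ℕ, coeff ν (RBullet lam tau - 1) =
          if ν = 0 then 0 else weight lam tau ν := by
        intro ν
        rw [map_sub, coeff_one]
        change weight lam tau ν - _ = _
        split_ifs with h
        · rw [h, h0, sub_self]
        · rw [sub_zero]
      split_ifs with hl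
      · exact Finset.prod_congr rfl fun i _ => by rw [hcoef, if_neg (hl i)]
      · push Not at hl
        obtain ⟨i, hi⟩ := hl
        exact Finset.prod_eq_zero (Finset.mem_univ i) (by rw [hcoef, if_pos hi])
  intro μ N hN
  rw [logTrunc, map_sum]
  simp only [coeff_C_mul, hpow]
  change ∑ n ∈ Finset.Icc 1 (length μ), _ = _
  refine Finset.sum_subset (Finset.Icc_subset_Icc_right hN) fun n hn hn' => ?_
  rw [← hpow, coeff_pow_eq_zero (constantCoeff_sub_one hc), mul_zero]
  simp only [Finset.mem_Icc] at hn hn'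
  omega

/-! ### Products of a permutation with transpositions -/

section Perm

open Equiv Equiv.Perm

variable {α : Type*} [DecidableEq α]

/-- Since `swap x y` is an involution, this one identity gives both the cut of a cycle and the join
of two. -/
theorem formPerm_cons_append_cons (x y : α) (a b : List α) (h : (x :: a ++ y :: b).Nodup) :
    (x :: a ++ y :: b).formPerm = swap x y * (x :: a).formPerm * (y :: b).formPerm := by
  induction a generalizing x with
  | nil => simp
  | cons z a ih =>
    have hz : (z :: a ++ y :: b).Nodup := (List.nodup_cons.1 h).2
    have hxz : x ≠ z := by
      rintro rfl
      simp at h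
    have hyz : y ≠ z := by
      rintro rfl
      simp at hz
    have hxy : x ≠ y := by
      rintro rfl
      simp at h
    have h1 : swap x z * swap z y = swap x y * swap x z := by
      have := swap_mul_swap_mul_swap hyz hxy.symm
      rw [swap_comm z y, ← this, swap_comm z x]
      simp only [mul_assoc, swap_mul_self, mul_one]
    have e : x :: z :: a ++ y :: b = x :: z :: (a ++ y :: b) := rfl
    rw [e, List.formPerm_cons_cons, List.formPerm_cons_cons]
    have e2 : (z :: (a ++ y :: b)).formPerm = _ := ih z hz
    rw [e2]
    simp only [← mul_assoc]
    rw [h1]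

variable [Fintype α]

/-- The two factors are disjoint: the points of l are fixed points of g, and the product merges them
into one cycle. The ones are added on the left to avoid subtracting multisets. -/
theorem parts_formPerm_mul (l : List α) (hl : l ≠ []) (hn : l.Nodup) (g : Perm α)
    (hg : ∀ z ∈ l, g z = z) :
    (l.formPerm * g).partition.parts + Multiset.replicate l.length 1 =
      l.length ::ₘ g.partition.parts := by
  rcases Nat.lt_or_ge l.length 2 with h1 | h2
  · obtain ⟨x, rfl⟩ : ∃ x, l = [x] := by
      rw [← List.length_eq_one_iff]
      have := List.length_pos_iff.2 hl
      omega
    rw [List.formPerm_singleton, one_mul]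
    simp [add_comm]
  · have hd : Perm.Disjoint l.formPerm g := by
      intro z
      by_cases hz : z ∈ l
      · exact Or.inr (hg z hz)
      · exact Or.inl (List.formPerm_apply_of_notMem hz)
    have hct : l.formPerm.cycleType = {l.length} := by
      rw [(List.isCycle_formPerm hn h2).cycleType, List.support_formPerm_of_nodup l hn
        (by rintro x rfl; simp at h2), List.toFinset_card_of_nodup hn]
    have hs : l.formPerm.support.card = l.length := by
      rw [← sum_cycleType, hct, Multiset.sum_singleton]
    rw [parts_partition, parts_partition, hd.cycleType_mul, hd.card_support_mul, hct, hs,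
      add_assoc, ← Multiset.replicate_add, Multiset.singleton_add, Multiset.cons_add]
    have hle : (l.formPerm * g).support.card ≤ Fintype.card α := Finset.card_le_univ _
    rw [hd.card_support_mul, hs] at hle
    congr 3
    omega

/-- Two cycles of `g`, merged or separated by the transposition `swap x y`. -/
theorem parts_swap_mul_formPerm (x y : α) (a b : List α) (h : (x :: a ++ y :: b).Nodup)
    (g : Perm α) (hg : ∀ z ∈ x :: a ++ y :: b, g z = z) :
    (a.length + b.length + 2) ::ₘ ((x :: a).formPerm * (y :: b).formPerm * g).partition.parts =
      (a.length + 1) ::ₘ (b.length + 1) ::ₘ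
        ((x :: a ++ y :: b).formPerm * g).partition.parts := by
  have h1 := parts_formPerm_mul _ (by simp) h g hg
  have hx : (x :: a).Nodup := h.sublist (List.sublist_append_left _ _)
  have hy : (y :: b).Nodup := h.sublist (List.sublist_append_right _ _)
  have h2 := parts_formPerm_mul (y :: b) (by simp) hy g
    fun z hz => hg z (List.mem_append_right _ hz)
  have h3 := parts_formPerm_mul (x :: a) (by simp) hx ((y :: b).formPerm * g) fun z hz => by
    rw [Perm.mul_apply, hg z (List.mem_append_left _ hz), List.formPerm_apply_of_notMem]
    exact fun hz' => (List.nodup_append.1 h).2.2 z hz z hz' rfl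
  rw [← mul_assoc] at h3
  have e1 : (x :: a ++ y :: b).length = a.length + b.length + 2 := by simp; omega
  have e2 : (x :: a).length = a.length + 1 := by simp
  have e3 : (y :: b).length = b.length + 1 := by simp
  rw [e1] at h1
  rw [e2] at h3
  rw [e3] at h2
  have e4 : a.length + b.length + 2 = (a.length + 1) + (b.length + 1) := by omega
  -- Padded with the ones that g has on these points, both sides reduce to the parts of g.
  apply add_right_cancel (b := Multiset.replicate (a.length + b.length + 2) 1)
  rw [Multiset.cons_add, Multiset.cons_add, Multiset.cons_add, h1]
  have h4 : ((x :: a).formPerm * (y :: b).formPerm * g).partition.parts +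
      Multiset.replicate (a.length + b.length + 2) 1 =
      (a.length + 1) ::ₘ (b.length + 1) ::ₘ g.partition.parts := by
    rw [e4, Multiset.replicate_add, ← add_assoc, h3, Multiset.cons_add, h2]
  rw [h4, Multiset.cons_swap, Multiset.cons_swap (a.length + b.length + 2)]

/-- A cycle of `g` through `x` as a list without repetitions. -/
theorem exists_cycle_list (g : Perm α) (x : α) :
    ∃ a : List α, (x :: a).Nodup ∧ (∀ z, z ∈ x :: a ↔ g.SameCycle x z) ∧
      ∀ z ∈ x :: a, g z = (x :: a).formPerm z := by
  -- For a fixed point `toList g x` is empty, so the list [x] is supplied by hand.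
  by_cases hx : g x = x
  · refine ⟨[], by simp, fun z => ?_, fun z hz => ?_⟩
    · rw [List.mem_singleton]
      exact ⟨fun h => h ▸ SameCycle.refl _ _, fun h => (h.eq_of_left hx).symm⟩
    · rw [List.mem_singleton] at hz
      rw [hz, List.formPerm_singleton, hx, one_apply]
  · have hx' : x ∈ g.support := mem_support.2 hx
    have hpos := length_toList_pos_of_mem_support g x hx'
    obtain ⟨x', a, hxa⟩ : ∃ x' a, toList g x = x' :: a :=
      List.exists_cons_of_length_pos hpos
    have h0 := toList_getElem_zero g x hx'
    have : x' = x := by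
      simpa [hxa] using h0
    subst this
    have hmem : ∀ z, z ∈ x' :: a ↔ g.SameCycle x' z := fun z => by
      rw [← hxa, mem_toList_iff]
      exact and_iff_left hx'
    refine ⟨a, hxa ▸ nodup_toList g x', hmem, fun z hz => ?_⟩
    rw [← hxa, formPerm_toList, ((hmem z).1 hz).cycleOf_apply]

/-- The number of elements of the cycle of `g` through `x`. -/
def cycleSize (g : Perm α) (x : α) : ℕ := (Finset.univ.filter fun y => g.SameCycle x y).card

theorem cycleSize_eq_length {g : Perm α} {x : α} {a : List α} (hn : (x :: a).Nodup)
    (h : ∀ z, z ∈ x :: a ↔ g.SameCycle x z) : cycleSize g x = a.length + 1 := by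
  have : (Finset.univ.filter fun y => g.SameCycle x y) = (x :: a).toFinset := by
    ext z
    rw [Finset.mem_filter, List.mem_toFinset, h]
    simp
  rw [cycleSize, this, List.toFinset_card_of_nodup hn, List.length_cons]

theorem cycleSize_congr {g : Perm α} {x y : α} (h : g.SameCycle x y) :
    cycleSize g x = cycleSize g y := by
  unfold cycleSize
  congr 1
  ext z
  simp only [Finset.mem_filter, Finset.mem_univ, true_and]
  exact ⟨fun hz => h.symm.trans hz, fun hz => h.trans hz⟩

theorem cycleSize_mem_parts (g : Perm α) (x : α) : cycleSize g x ∈ g.partition.parts := by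
  obtain ⟨a, hn, hmem, hg⟩ := exists_cycle_list g x
  rw [cycleSize_eq_length hn hmem]
  have hgm : g = (x :: a).formPerm * ((x :: a).formPerm⁻¹ * g) := by group
  have hfix : ∀ z ∈ x :: a, ((x :: a).formPerm⁻¹ * g) z = z := fun z hz => by
    rw [Perm.mul_apply, hg z hz, Perm.inv_def, symm_apply_apply]
  have hp := parts_formPerm_mul (x :: a) (by simp) hn _ hfix
  rw [← hgm] at hp
  have : a.length + 1 ∈ g.partition.parts + Multiset.replicate (x :: a).length 1 := by
    rw [hp]
    simp
  rcases Multiset.mem_add.1 this with h | h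
  · exact h
  · have h1 := Multiset.eq_of_mem_replicate h
    rw [h1, parts_partition]
    rcases a with _ | ⟨y, a⟩
    · have hx : g x = x := by simpa using hg x (by simp)
      refine Multiset.mem_add.2 (Or.inr (Multiset.mem_replicate.2 ⟨?_, rfl⟩))
      have hlt : g.support.card < Fintype.card α := by
        rw [← Finset.card_univ]
        refine Finset.card_lt_card (Finset.ssubset_univ_iff.2 fun h => ?_)
        have := h.symm ▸ Finset.mem_univ x
        exact mem_support.1 this hx
      omega
    · simp at h1

/-- The entry a[k] is k + 1 places after x, so the cycle is cut into an arc of 1 + k points starting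
at x and the remaining arc starting at a[k]. -/
theorem parts_swap_mul_of_sameCycle {g : Perm α} {x : α} {a : List α} (hn : (x :: a).Nodup)
    (hmem : ∀ z, z ∈ x :: a ↔ g.SameCycle x z) (hg : ∀ z ∈ x :: a, g z = (x :: a).formPerm z)
    {k : ℕ} (hk : k < a.length) :
    (swap x a[k] * g).partition.parts = (1 + k) ::ₘ (cycleSize g x - (1 + k)) ::ₘ
      g.partition.parts.erase (cycleSize g x) := by
  have hmemT := cycleSize_mem_parts g x
  rw [cycleSize_eq_length hn hmem] at hmemT ⊢
  have hsplit : x :: a = x :: a.take k ++ a[k] :: a.drop (k + 1) := by simp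
  have hgm : g = (x :: a).formPerm * ((x :: a).formPerm⁻¹ * g) := by group
  have hfix : ∀ z ∈ x :: a, ((x :: a).formPerm⁻¹ * g) z = z := fun z hz => by
    rw [Perm.mul_apply, hg z hz, Perm.inv_def, symm_apply_apply]
  generalize (x :: a).formPerm⁻¹ * g = g' at hgm hfix
  have key := parts_swap_mul_formPerm x a[k] (a.take k) (a.drop (k + 1))
    (hsplit ▸ hn) g' (hsplit ▸ hfix)
  have hsw : swap x a[k] * g =
      (x :: a.take k).formPerm * (a[k] :: a.drop (k + 1)).formPerm * g' := by
    have := formPerm_cons_append_cons x a[k] (a.take k) (a.drop (k + 1)) (hsplit ▸ hn)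
    rw [hgm, hsplit, this]
    simp only [← mul_assoc]
    rw [swap_mul_self, one_mul]
  rw [← hsw, ← hsplit, ← hgm] at key
  have e1 : (a.take k).length = k := by simp; omega
  have e2 : (a.drop (k + 1)).length = a.length - (k + 1) := by simp
  rw [e1, e2] at key
  have e3 : k + (a.length - (k + 1)) + 2 = a.length + 1 := by omega
  have e4 : a.length - (k + 1) + 1 = a.length + 1 - (k + 1) := by omega
  rw [e3, e4] at key
  rw [add_comm 1 k, ← Multiset.cons_inj_right (a.length + 1), key]
  conv_lhs => rw [← Multiset.cons_erase hmemT]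
  rw [Multiset.cons_swap (a.length + 1 - (k + 1)), Multiset.cons_swap (k + 1)]

/-- As y runs through the other points of the cycle of x, the distance from x to y takes each value
from 1 to the cycle length minus 1 once. -/
theorem sum_swap_mul_of_sameCycle {M : Type*} [AddCommMonoid M] (f : Multiset ℕ → M)
    (g : Perm α) (x : α) :
    ∑ y with g.SameCycle x y ∧ y ≠ x, f (swap x y * g).partition.parts =
      ∑ k ∈ Finset.Ico 1 (cycleSize g x),
        f (k ::ₘ (cycleSize g x - k) ::ₘ g.partition.parts.erase (cycleSize g x)) := by
  obtain ⟨a, hn, hmem, hg⟩ := exists_cycle_list g x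
  have hc := cycleSize_eq_length hn hmem
  have hx := (List.nodup_cons.1 hn).1
  have hset : (Finset.univ.filter fun y => g.SameCycle x y ∧ y ≠ x) = a.toFinset := by
    ext z
    rw [Finset.mem_filter, List.mem_toFinset, ← hmem]
    constructor
    · rintro ⟨-, h1, h2⟩
      exact (List.mem_cons.1 h1).resolve_left h2
    · intro hz
      exact ⟨Finset.mem_univ _, List.mem_cons_of_mem _ hz, by rintro rfl; exact hx hz⟩
  have hna : a.Nodup := (List.nodup_cons.1 hn).2
  rw [hset, Finset.sum_Ico_eq_sum_range, hc, Nat.add_sub_cancel, ← hc]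
  symm
  refine Finset.sum_bij (fun k hk => a[k]'(Finset.mem_range.1 hk)) ?_ ?_ ?_ ?_
  · intro k hk
    simp
  · intro k hk l hl h
    exact (hna.getElem_inj_iff).1 h
  · intro y hy
    obtain ⟨k, hk, rfl⟩ := List.getElem_of_mem (List.mem_toFinset.1 hy)
    exact ⟨k, Finset.mem_range.2 hk, rfl⟩
  · intro k hk
    rw [parts_swap_mul_of_sameCycle hn hmem hg (Finset.mem_range.1 hk)]

/-- The lists of the two cycles can be concatenated without repetition. The membership claim ensures
that the two erasures remove two parts, even when the sizes agree. -/
theorem parts_swap_mul_of_not_sameCycle {g : Perm α} {x y : α} (hxy : ¬ g.SameCycle x y) :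
    (swap x y * g).partition.parts = (cycleSize g x + cycleSize g y) ::ₘ
      (g.partition.parts.erase (cycleSize g x)).erase (cycleSize g y) ∧
    cycleSize g y ∈ g.partition.parts.erase (cycleSize g x) := by
  obtain ⟨a, hn, hmem, hg⟩ := exists_cycle_list g x
  obtain ⟨b, hn', hmem', hg'⟩ := exists_cycle_list g y
  rw [cycleSize_eq_length hn hmem, cycleSize_eq_length hn' hmem']
  have hdis : ∀ z ∈ x :: a, z ∉ y :: b := fun z hz hz' =>
    hxy (((hmem z).1 hz).trans ((hmem' z).1 hz').symm)
  have hnab : (x :: a ++ y :: b).Nodup :=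
    List.nodup_append.2 ⟨hn, hn', fun z hz w hw h => hdis z hz (h ▸ hw)⟩
  have inv_eq : ∀ {l : List α} {z w : α}, l.formPerm w = z → l.formPerm⁻¹ z = w := by
    rintro l z w rfl
    rw [Perm.inv_def, symm_apply_apply]
  have hfix : ∀ z ∈ x :: a ++ y :: b,
      ((y :: b).formPerm⁻¹ * (x :: a).formPerm⁻¹ * g) z = z := by
    intro z hz
    rw [Perm.mul_apply, Perm.mul_apply]
    rcases List.mem_append.1 hz with hz | hz
    · rw [hg z hz, inv_eq rfl]
      exact inv_eq (List.formPerm_apply_of_notMem (hdis z hz))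
    · rw [hg' z hz]
      have h1 : (y :: b).formPerm z ∈ y :: b := List.formPerm_apply_mem_of_mem hz
      rw [inv_eq (List.formPerm_apply_of_notMem fun h => hdis _ h h1), inv_eq rfl]
  have hgm : g = (x :: a).formPerm * (y :: b).formPerm *
      ((y :: b).formPerm⁻¹ * (x :: a).formPerm⁻¹ * g) := by group
  generalize (y :: b).formPerm⁻¹ * (x :: a).formPerm⁻¹ * g = g' at hgm hfix
  have key := parts_swap_mul_formPerm x y a b hnab g' hfix
  rw [← hgm] at key
  have hsw : swap x y * g = (x :: a ++ y :: b).formPerm * g' := by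
    rw [formPerm_cons_append_cons x y a b hnab, hgm]
    simp only [mul_assoc]
  rw [← hsw] at key
  have hx := cycleSize_mem_parts g x
  have hy : b.length + 1 ∈ g.partition.parts.erase (a.length + 1) := by
    rw [cycleSize_eq_length hn hmem] at hx
    have h1 : b.length + 1 ∈ (a.length + b.length + 2) ::ₘ g.partition.parts := by
      rw [key]
      simp
    rw [← Multiset.cons_erase hx, Multiset.cons_swap] at key
    rw [Multiset.cons_inj_right] at key
    have h2 : b.length + 1 ∈ (a.length + b.length + 2) ::ₘ g.partition.parts.erase (a.length + 1) := by
      rw [key]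
      simp
    exact (Multiset.mem_cons.1 h2).resolve_left (by omega)
  refine ⟨?_, hy⟩
  rw [cycleSize_eq_length hn hmem] at hx
  rw [← Multiset.cons_inj_right (b.length + 1), ← Multiset.cons_inj_right (a.length + 1), ← key]
  conv_lhs => rw [← Multiset.cons_erase hx, ← Multiset.cons_erase hy]
  have e : a.length + 1 + (b.length + 1) = a.length + b.length + 2 := by omega
  rw [e, Multiset.cons_swap, Multiset.cons_swap (a.length + b.length + 2)]

/-- A cycle of length n has n points, each with value φ n. The moved points are grouped by their
cycle factor; the fixed points are the parts equal to 1. -/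
theorem sum_cycleSize {M : Type*} [AddCommMonoid M] (φ : ℕ → M) (g : Perm α) :
    ∑ x, φ (cycleSize g x) = (g.partition.parts.map fun n => n • φ n).sum := by
  have hsize : ∀ x ∈ g.support, cycleSize g x = (g.cycleOf x).support.card := by
    intro x hx
    rw [cycleSize]
    congr 1
    ext z
    rw [Finset.mem_filter, mem_support_cycleOf_iff]
    simp [mem_support.1 hx]
  have hone : ∀ x ∈ g.supportᶜ, cycleSize g x = 1 := by
    intro x hx
    have hx' : g x = x := by simpa using hx
    rw [cycleSize, Finset.card_eq_one]
    refine ⟨x, ?_⟩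
    ext z
    simp only [Finset.mem_filter, Finset.mem_univ, true_and, Finset.mem_singleton]
    exact ⟨fun h => (h.eq_of_left hx').symm, fun h => h ▸ SameCycle.refl _ _⟩
  rw [← Finset.sum_add_sum_compl g.support, parts_partition, Multiset.map_add, Multiset.sum_add]
  congr 1
  · rw [cycleType_def, Multiset.map_map]
    change _ = ∑ c ∈ g.cycleFactorsFinset, c.support.card • φ c.support.card
    rw [← Finset.sum_fiberwise_of_maps_to (g := fun x => g.cycleOf x)
      fun x hx => cycleOf_mem_cycleFactorsFinset_iff.2 hx]
    refine Finset.sum_congr rfl fun c hc => ?_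
    rw [← Finset.sum_const]
    have hset : (g.support.filter fun x => g.cycleOf x = c) = c.support := by
      ext x
      rw [Finset.mem_filter, eq_comm, eq_cycleOf_of_mem_cycleFactorsFinset_iff g c hc]
      exact and_iff_right_of_imp fun h => mem_cycleFactorsFinset_support_le hc h
    rw [hset]
    refine Finset.sum_congr rfl fun x hx => ?_
    rw [hsize x (mem_cycleFactorsFinset_support_le hc hx), ← cycle_is_cycleOf hx hc]
  · rw [Finset.sum_congr rfl fun x hx => by rw [hone x hx]]
    rw [Finset.sum_const, Finset.card_compl, Multiset.map_replicate, Multiset.sum_replicate,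
      one_smul]

/-- The cycle types of the products of `g` with all transpositions. -/
theorem sum_swap_mul (f : Multiset ℕ → ℂ) (g : Perm α) :
    ∑ x, ∑ y with y ≠ x, f (swap x y * g).partition.parts =
      (g.partition.parts.map fun n : ℕ => (n : ℂ) * (∑ k ∈ Finset.Ico 1 n,
          f (k ::ₘ (n - k) ::ₘ g.partition.parts.erase n) +
        ((g.partition.parts.erase n).map fun m : ℕ =>
          (m : ℂ) * f ((n + m) ::ₘ (g.partition.parts.erase n).erase m)).sum)).sum := by
  simp only [← nsmul_eq_mul]
  rw [← sum_cycleSize]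
  refine Finset.sum_congr rfl fun x _ => ?_
  rw [← Finset.sum_filter_add_sum_filter_not _ (fun y => g.SameCycle x y), Finset.filter_filter,
    Finset.filter_filter]
  congr 1
  · rw [← sum_swap_mul_of_sameCycle]
    exact Finset.sum_congr (by ext; simp [and_comm]) fun _ _ => rfl
  · have hset : (Finset.univ.filter fun y => y ≠ x ∧ ¬ g.SameCycle x y) =
        Finset.univ.filter fun y => ¬ g.SameCycle x y := by
      ext y
      simp only [Finset.mem_filter, Finset.mem_univ, true_and, and_iff_right_iff_imp]
      rintro h rfl
      exact h (SameCycle.refl _ _)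
    rw [hset]
    set n := cycleSize g x
    set φ : ℕ → ℂ := fun m => f ((n + m) ::ₘ (g.partition.parts.erase n).erase m)
    have h1 : ∑ y with ¬ g.SameCycle x y, f (swap x y * g).partition.parts =
        ∑ y with ¬ g.SameCycle x y, φ (cycleSize g y) :=
      Finset.sum_congr rfl fun y hy => by
        rw [(parts_swap_mul_of_not_sameCycle (Finset.mem_filter.1 hy).2).1]
    -- The points outside the cycle of x are counted as all points minus the n points of that cycle,
    -- which amounts to erasing one part n.
    have h2 := Finset.sum_filter_add_sum_filter_not Finset.univ (fun y => g.SameCycle x y)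
      (fun y => φ (cycleSize g y))
    have h3 : ∑ y with g.SameCycle x y, φ (cycleSize g y) = n • φ n := by
      rw [Finset.sum_congr rfl fun y hy => by
        rw [← cycleSize_congr (Finset.mem_filter.1 hy).2], Finset.sum_const]
      rfl
    rw [sum_cycleSize, h3] at h2
    have h4 : (g.partition.parts.map fun m => m • φ m).sum =
        n • φ n + ((g.partition.parts.erase n).map fun m => m • φ m).sum := by
      conv_lhs => rw [← Multiset.cons_erase (cycleSize_mem_parts g x)]
      rw [Multiset.map_cons, Multiset.sum_cons]
    rw [h1]
    rw [h4] at h2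
    exact add_left_cancel h2

end Perm

/-! ### The cut-and-join operator on monomials -/

theorem parts_injective : Function.Injective parts := fun _ _ h =>
  Function.LeftInverse.injective Finsupp.toMultiset_toFinsupp (Multiset.map_injective PNat.coe_injective h)

theorem parts_single_add (i : ℕ+) (σ : ℕ+ →₀ ℕ) :
    parts (Finsupp.single i 1 + σ) = (i : ℕ) ::ₘ parts σ := by
  simp [parts, Finsupp.toMultiset_single]

theorem parts_sub_single (i : ℕ+) (σ : ℕ+ →₀ ℕ) :
    parts (σ - Finsupp.single i 1) = (parts σ).erase i := by
  by_cases h : σ i = 0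
  · have h1 : σ - Finsupp.single i 1 = σ := by
      ext j
      by_cases hj : i = j
      · subst hj
        simp [h]
      · simp [Finsupp.single_eq_of_ne' hj]
    rw [h1, Multiset.erase_of_notMem]
    intro hi
    obtain ⟨j, hj, hji⟩ := Multiset.mem_map.1 hi
    rw [PNat.coe_injective hji, Finsupp.mem_toMultiset, Finsupp.mem_support_iff] at hj
    exact hj h
  · have h1 : Finsupp.single i 1 + (σ - Finsupp.single i 1) = σ :=
      add_tsub_cancel_of_le (Finsupp.single_le_iff.2 (Nat.one_le_iff_ne_zero.2 h))
    conv_rhs => rw [← h1, parts_single_add]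
    rw [Multiset.erase_cons_head]

theorem exists_parts_eq (M : Multiset ℕ) (hM : ∀ n ∈ M, 0 < n) : ∃ σ, parts σ = M := by
  induction M using Multiset.induction_on with
  | empty => exact ⟨0, by simp [parts]⟩
  | cons n M ih =>
    obtain ⟨σ, rfl⟩ := ih fun m hm => hM m (Multiset.mem_cons_of_mem hm)
    exact ⟨Finsupp.single ⟨n, hM n (Multiset.mem_cons_self _ _)⟩ 1 + σ, parts_single_add _ _⟩

theorem sum_map_parts (φ : ℕ → ℂ) (σ : ℕ+ →₀ ℕ) {s : Finset ℕ+} (hs : σ.support ⊆ s) :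
    ((parts σ).map φ).sum = ∑ i ∈ s, (σ i : ℂ) * φ i := by
  have h1 : ((parts σ).map φ).sum = σ.sum fun i k => (k : ℂ) * φ i := by
    clear hs
    induction σ using Finsupp.induction_linear with
    | zero => simp [parts]
    | add σ τ h1 h2 =>
      rw [Finsupp.sum_add_index' (by simp) (by intros; push_cast; ring)]
      have e : parts (σ + τ) = parts σ + parts τ := by simp [parts]
      rw [e, Multiset.map_add, Multiset.sum_add]
      rw [h1, h2]
    | single i k =>
      simp [parts, Finsupp.toMultiset_single, Multiset.map_nsmul, Multiset.sum_nsmul]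
  rw [h1]
  exact Finsupp.sum_of_support_subset _ hs _ (by simp)

/-- The term of the linear cut-and-join operator with indices `i` and `j`. -/
noncomputable def cutJoin (i j : ℕ+) (F : MvPowerSeries ℕ+ ℂ) : MvPowerSeries ℕ+ ℂ :=
  nat (i * j) * p (i + j) * D i (D j F) + nat (i + j) * p i * p j * D (i + j) F

theorem pderiv_monomial (i : ℕ+) (σ : ℕ+ →₀ ℕ) (a : ℂ) :
    pderiv ℂ i (monomial σ a) = monomial (σ - Finsupp.single i 1) (a * σ i) := by
  rw [← MvPolynomial.coe_monomial, pderiv_coe, MvPolynomial.pderiv_monomial,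
    MvPolynomial.coe_monomial]

/-- Taking f to be the indicator of the parts of μ expresses the coefficients in the language of
`sum_swap_mul`. If a part to be removed is missing from σ, the truncated subtraction is harmless
because a multiplicity factor vanishes. -/
theorem coeff_cutJoin_monomial (μ σ : ℕ+ →₀ ℕ) (f : Multiset ℕ → ℂ)
    (hf : ∀ τ, f (parts τ) = if μ = τ then 1 else 0) (i j : ℕ+) :
    coeff μ (cutJoin i j (monomial σ 1)) =
      (σ j : ℂ) * ((j : ℂ) * ((((σ - Finsupp.single j 1 : ℕ+ →₀ ℕ) i : ℕ) : ℂ) *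
        ((i : ℂ) * f ((j + i) ::ₘ ((parts σ).erase j).erase i)))) +
      (σ (i + j) : ℂ) * (((i + j : ℕ+) : ℂ) *
        f (i ::ₘ j ::ₘ (parts σ).erase (i + j : ℕ+))) := by
  classical
  have h1 : cutJoin i j (monomial σ 1) =
      monomial (Finsupp.single (j + i) 1 + (σ - Finsupp.single j 1 - Finsupp.single i 1))
        ((i : ℂ) * j * σ j * ((σ - Finsupp.single j 1 : ℕ+ →₀ ℕ) i : ℕ)) +
      monomial (Finsupp.single i 1 + (Finsupp.single j 1 + (σ - Finsupp.single (i + j) 1)))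
        (((i + j : ℕ+) : ℂ) * σ (i + j)) := by
    rw [cutJoin]
    simp only [D, pderiv_monomial, p, X_def, nat, ← monomial_zero_eq_C_apply,
      monomial_mul_monomial, zero_add, one_mul, mul_one, add_comm i j]
    congr 2
    · push_cast
      ring
    · rw [add_assoc]
    · push_cast
      ring
  rw [h1, map_add, coeff_monomial, coeff_monomial, ← parts_sub_single, ← parts_sub_single,
    ← parts_sub_single, ← PNat.add_coe, ← parts_single_add, ← parts_single_add,
    ← parts_single_add, hf, hf]
  split_ifs <;> ring

/-- The right side is that of `sum_swap_mul` for a permutation of cycle type σ. Joins A live on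
pairs of parts of σ, cuts B on pairs whose sum is a part of σ; both sets are finite. -/
theorem finsum_coeff_cutJoin_monomial (μ σ : ℕ+ →₀ ℕ) (f : Multiset ℕ → ℂ)
    (hf : ∀ τ, f (parts τ) = if μ = τ then 1 else 0) :
    (Function.support fun ij : ℕ+ × ℕ+ =>
      coeff μ (cutJoin ij.1 ij.2 (monomial σ 1))).Finite ∧
    ∑ᶠ ij : ℕ+ × ℕ+, coeff μ (cutJoin ij.1 ij.2 (monomial σ 1)) =
      ((parts σ).map fun n : ℕ => (n : ℂ) * (∑ k ∈ Finset.Ico 1 n,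
          f (k ::ₘ (n - k) ::ₘ (parts σ).erase n) +
        (((parts σ).erase n).map fun m : ℕ =>
          (m : ℂ) * f ((n + m) ::ₘ ((parts σ).erase n).erase m)).sum)).sum := by
  classical
  set s := σ.support
  let A : ℕ+ × ℕ+ → ℂ := fun ij => (σ ij.2 : ℂ) * ((ij.2 : ℂ) *
    ((((σ - Finsupp.single ij.2 1 : ℕ+ →₀ ℕ) ij.1 : ℕ) : ℂ) *
        ((ij.1 : ℂ) * f ((ij.2 + ij.1) ::ₘ ((parts σ).erase ij.2).erase ij.1))))
  let B : ℕ+ × ℕ+ → ℂ := fun ij => (σ (ij.1 + ij.2) : ℂ) * (((ij.1 + ij.2 : ℕ+) : ℂ) *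
        f (ij.1 ::ₘ ij.2 ::ₘ (parts σ).erase (ij.1 + ij.2 : ℕ+)))
  have hAB : (fun ij : ℕ+ × ℕ+ => coeff μ (cutJoin ij.1 ij.2 (monomial σ 1))) =
      fun ij => A ij + B ij := funext fun ij => coeff_cutJoin_monomial μ σ f hf ij.1 ij.2
  have hsub : ∀ j, (σ - Finsupp.single j 1).support ⊆ s := fun j i hi => by
    rw [Finsupp.mem_support_iff] at hi ⊢
    intro h
    exact hi (by simp [h])
  have hA : Function.support A ⊆ (s ×ˢ s : Finset (ℕ+ × ℕ+)) := by
    intro ij h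
    have h1 := left_ne_zero_of_mul h
    have h2 := left_ne_zero_of_mul (right_ne_zero_of_mul (right_ne_zero_of_mul h))
    rw [Finset.mem_coe, Finset.mem_product]
    exact ⟨hsub ij.2 (Finsupp.mem_support_iff.2 (by exact_mod_cast h2)),
      Finsupp.mem_support_iff.2 (by exact_mod_cast h1)⟩
  let t : ℕ+ → Finset (ℕ+ × ℕ+) := fun n =>
    (Finset.Icc 1 n ×ˢ Finset.Icc 1 n).filter fun ij => ij.1 + ij.2 = n
  have ht : ∀ n ij, ij ∈ t n ↔ ij.1 + ij.2 = n := by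
    intro n ij
    simp only [t, Finset.mem_filter, Finset.mem_product, Finset.mem_Icc, one_le, true_and,
      and_iff_right_iff_imp]
    rintro rfl
    exact ⟨(PNat.lt_add_right _ _).le, (PNat.lt_add_left _ _).le⟩
  have hB : Function.support B ⊆ (s.biUnion t : Finset (ℕ+ × ℕ+)) := by
    intro ij h
    have h1 := left_ne_zero_of_mul h
    rw [Finset.mem_coe, Finset.mem_biUnion]
    exact ⟨ij.1 + ij.2, Finsupp.mem_support_iff.2 (by exact_mod_cast h1), (ht _ _).2 rfl⟩
  have hAfin : (Function.support A).Finite := (Finset.finite_toSet _).subset hA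
  have hBfin : (Function.support B).Finite := (Finset.finite_toSet _).subset hB
  rw [hAB]
  refine ⟨(hAfin.union hBfin).subset (Function.support_add _ _), ?_⟩
  have hAsum : ∑ᶠ ij, A ij = ∑ n ∈ s, (σ n : ℂ) * ((n : ℂ) *
      (((parts σ).erase n).map fun m : ℕ =>
          (m : ℂ) * f ((n + m) ::ₘ ((parts σ).erase n).erase m)).sum) := by
    rw [finsum_eq_sum_of_support_subset _ hA, Finset.sum_product_right]
    refine Finset.sum_congr rfl fun j _ => ?_
    rw [← parts_sub_single, sum_map_parts _ _ (hsub j), Finset.mul_sum, Finset.mul_sum]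
    refine Finset.sum_congr rfl fun i _ => ?_
    simp only [A, parts_sub_single]
  have hBsum : ∑ᶠ ij, B ij = ∑ n ∈ s, (σ n : ℂ) * ((n : ℂ) *
      ∑ k ∈ Finset.Ico 1 (n : ℕ), f (k ::ₘ (n - k) ::ₘ (parts σ).erase n)) := by
    rw [finsum_eq_sum_of_support_subset _ hB, Finset.sum_biUnion]
    · refine Finset.sum_congr rfl fun n _ => ?_
      rw [Finset.mul_sum, Finset.mul_sum]
      refine Finset.sum_bij (fun ij _ => (ij.1 : ℕ)) ?_ ?_ ?_ ?_
      · intro ij hij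
        rw [ht] at hij
        rw [Finset.mem_Ico, ← hij, PNat.add_coe]
        have := ij.1.pos
        have := ij.2.pos
        omega
      · intro x hx y hy h
        rw [ht] at hx hy
        have h1 : x.1 = y.1 := PNat.coe_injective h
        refine Prod.ext h1 ?_
        rw [← hy, h1] at hx
        exact add_left_cancel hx
      · intro k hk
        rw [Finset.mem_Ico] at hk
        refine ⟨(⟨k, by omega⟩, ⟨n - k, by omega⟩), (ht _ _).2 ?_, rfl⟩
        apply PNat.coe_injective
        change k + ((n : ℕ) - k) = n
        omega
      · intro ij hij
        rw [ht] at hij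
        simp only [B, hij]
        have h1 : (n : ℕ) - ij.1 = ij.2 := by
          rw [← hij, PNat.add_coe]
          omega
        rw [h1]
    · intro m _ n _ hmn
      rw [Function.onFun, Finset.disjoint_left]
      intro ij h1 h2
      rw [ht] at h1 h2
      exact hmn (h1.symm.trans h2)
  rw [finsum_add_distrib hAfin hBfin, hAsum, hBsum, sum_map_parts _ _ subset_rfl,
    ← Finset.sum_add_distrib]
  refine Finset.sum_congr rfl fun n _ => ?_
  ring

/-! ### Homogeneity of the operator -/

theorem size_add (μ ν : ℕ+ →₀ ℕ) : size (μ + ν) = size μ + size ν := by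
  rw [← parts_sum, ← parts_sum, ← parts_sum]
  simp [parts]

theorem size_single (i : ℕ+) (k : ℕ) : size (Finsupp.single i k) = k * i := by
  simp [size]

theorem coeff_X_mul_eq (μ : ℕ+ →₀ ℕ) (i : ℕ+) (F : MvPowerSeries ℕ+ ℂ) :
    coeff μ (X i * F) =
      if Finsupp.single i 1 ≤ μ then coeff (μ - Finsupp.single i 1) F else 0 := by
  classical
  rw [X_def, coeff_monomial_mul]
  split_ifs <;> simp

/-- The operator with indices `i` and `j` is homogeneous of degree zero. -/
theorem coeff_cutJoin_congr {μ : ℕ+ →₀ ℕ} {F G : MvPowerSeries ℕ+ ℂ}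
    (h : ∀ ν, size ν = size μ → coeff ν F = coeff ν G) (i j : ℕ+) :
    coeff μ (cutJoin i j F) = coeff μ (cutJoin i j G) := by
  simp only [cutJoin, D, p, nat, mul_assoc, map_add, coeff_C_mul, coeff_X_mul_eq, coeff_pderiv]
  have hs : ∀ {k : ℕ+} {ν : ℕ+ →₀ ℕ}, Finsupp.single k 1 ≤ ν →
      size (ν - Finsupp.single k 1) + k = size ν := by
    intro k ν hk
    conv_rhs => rw [← tsub_add_cancel_of_le hk, size_add, size_single, one_mul]
  congr 2
  · split_ifs with h1
    · rw [h]
      have := hs h1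
      rw [PNat.add_coe] at this
      simp only [size_add, size_single]
      omega
    · rfl
  · split_ifs with h1 h2
    · rw [h]
      have e1 := hs h1
      have e2 := hs h2
      simp only [size_add, size_single, PNat.add_coe]
      omega
    · rfl
    · rfl

/-! ### Transpositions in the Specht modules -/

section Specht

open Equiv Equiv.Perm

variable {d : ℕ} (ν : Nat.Partition d)

/-- Twice the sum of all transpositions in the group algebra. -/
noncomputable def swapSum : MonoidAlgebra ℂ (SymGroup ν) :=
  ∑ x : Box ν, ∑ y : Box ν with y ≠ x, MonoidAlgebra.single (swap x y) 1

/-- Conjugation by g turns `swap x y` into `swap (g x) (g y)` and so permutes the ordered pairs of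
distinct boxes. -/
theorem swapSum_mul_comm (z : MonoidAlgebra ℂ (SymGroup ν)) : swapSum ν * z = z * swapSum ν := by
  induction z using MonoidAlgebra.induction_linear with
  | zero => simp
  | add f g hf hg => rw [mul_add, add_mul, hf, hg]
  | single g r =>
    simp only [swapSum, Finset.sum_mul, Finset.mul_sum, Finset.sum_filter]
    symm
    refine Fintype.sum_equiv g _ _ fun x => Fintype.sum_equiv g _ _ fun y => ?_
    rw [mul_ite, ite_mul, MonoidAlgebra.single_mul_single, MonoidAlgebra.single_mul_single,
      mul_swap_eq_swap_mul]
    simp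

theorem PreservesRows.mul {g h : SymGroup ν} (hg : PreservesRows ν g) (hh : PreservesRows ν h) :
    PreservesRows ν (g * h) := fun c => (hg (h c)).trans (hh c)

theorem PreservesCols.mul {g h : SymGroup ν} (hg : PreservesCols ν g) (hh : PreservesCols ν h) :
    PreservesCols ν (g * h) := fun c => (hg (h c)).trans (hh c)

theorem preservesRows_swap {x y : Box ν} (h : x.1.1 = y.1.1) : PreservesRows ν (swap x y) := by
  intro c
  rw [swap_apply_def]
  split_ifs with h1 h2
  · rw [h1, h]
  · rw [h2, h]
  · rfl

theorem preservesCols_swap {x y : Box ν} (h : x.1.2 = y.1.2) : PreservesCols ν (swap x y) := by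
  intro c
  rw [swap_apply_def]
  split_ifs with h1 h2
  · rw [h1, h]
  · rw [h2, h]
  · rfl

theorem rowSymmetrizer_mul_swap {x y : Box ν} (h : x.1.1 = y.1.1) :
    rowSymmetrizer ν * MonoidAlgebra.single (swap x y) 1 = rowSymmetrizer ν := by
  classical
  simp only [rowSymmetrizer, Finset.sum_mul, MonoidAlgebra.single_mul_single, mul_one]
  have hs := preservesRows_swap ν h
  refine Finset.sum_bij' (fun g _ => g * swap x y) (fun g _ => g * swap x y) ?_ ?_ ?_ ?_ ?_
  · intro g hg
    simp only [Finset.mem_filter, Finset.mem_univ, true_and] at hg ⊢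
    exact hg.mul ν hs
  · intro g hg
    simp only [Finset.mem_filter, Finset.mem_univ, true_and] at hg ⊢
    exact hg.mul ν hs
  · intro g _
    rw [mul_assoc, swap_mul_self, mul_one]
  · intro g _
    rw [mul_assoc, swap_mul_self, mul_one]
  · intro g _
    rfl

theorem swap_mul_colAntisymmetrizer {x y : Box ν} (hxy : x ≠ y) (h : x.1.2 = y.1.2) :
    MonoidAlgebra.single (swap x y) 1 * colAntisymmetrizer ν = -colAntisymmetrizer ν := by
  classical
  simp only [colAntisymmetrizer, Finset.mul_sum, MonoidAlgebra.single_mul_single, one_mul]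
  rw [← Finset.sum_neg_distrib]
  have hs := preservesCols_swap ν h
  refine Finset.sum_bij' (fun g _ => swap x y * g) (fun g _ => swap x y * g) ?_ ?_ ?_ ?_ ?_
  · intro g hg
    simp only [Finset.mem_filter, Finset.mem_univ, true_and] at hg ⊢
    exact hs.mul ν hg
  · intro g hg
    simp only [Finset.mem_filter, Finset.mem_univ, true_and] at hg ⊢
    exact hs.mul ν hg
  · intro g _
    rw [← mul_assoc, swap_mul_self, one_mul]
  · intro g _
    rw [← mul_assoc, swap_mul_self, one_mul]
  · intro g _
    rw [Perm.sign_mul, sign_swap hxy, ← MonoidAlgebra.single_neg]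
    simp

/-- Let v be the box in the row of x and the column of y; it lies above y, hence in the diagram.
Then a(x y)b = a(x v)(x y)b = a(x y)(y v)b = -a(x y)b. -/
theorem rowSymmetrizer_mul_swap_mul_eq_zero_of_lt {x y : Box ν} (h1 : x.1.1 < y.1.1)
    (h2 : x.1.2 ≠ y.1.2) :
    rowSymmetrizer ν * MonoidAlgebra.single (swap x y) 1 * colAntisymmetrizer ν = 0 := by
  have hv : (x.1.1, y.1.2) ∈ (diagram ν).cells :=
    (diagram ν).up_left_mem h1.le le_rfl y.2
  set v : Box ν := ⟨(x.1.1, y.1.2), hv⟩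
  have hvx : v ≠ x := fun h => h2 (congrArg (fun z : Box ν => z.1.2) h).symm
  have hvy : v ≠ y := fun h =>
    h1.ne (congrArg (fun z : Box ν => z.1.1) h :)
  have hc : swap x v * swap x y = swap x y * swap y v := by
    rw [mul_swap_eq_swap_mul (swap x y) y v, swap_apply_right, swap_apply_of_ne_of_ne hvx hvy]
  have key : rowSymmetrizer ν * MonoidAlgebra.single (swap x y) 1 * colAntisymmetrizer ν =
      -(rowSymmetrizer ν * MonoidAlgebra.single (swap x y) 1 * colAntisymmetrizer ν) := by
    conv_lhs => rw [← rowSymmetrizer_mul_swap ν (x := x) (y := v) rfl]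
    rw [mul_assoc (rowSymmetrizer ν), MonoidAlgebra.single_mul_single, hc, mul_one,
      ← mul_one (1 : ℂ), ← MonoidAlgebra.single_mul_single, ← mul_assoc, mul_assoc _ _
      (colAntisymmetrizer ν), swap_mul_colAntisymmetrizer ν hvy.symm rfl, mul_neg, mul_one]
  have h0 := add_eq_zero_iff_eq_neg.2 key
  rw [← two_smul ℂ] at h0
  exact (smul_eq_zero.1 h0).resolve_left two_ne_zero

theorem rowSymmetrizer_mul_swap_mul_eq_zero {x y : Box ν} (h1 : x.1.1 ≠ y.1.1)
    (h2 : x.1.2 ≠ y.1.2) :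
    rowSymmetrizer ν * MonoidAlgebra.single (swap x y) 1 * colAntisymmetrizer ν = 0 := by
  rcases h1.lt_or_gt with h | h
  · exact rowSymmetrizer_mul_swap_mul_eq_zero_of_lt ν h h2
  · rw [swap_comm]
    exact rowSymmetrizer_mul_swap_mul_eq_zero_of_lt ν h h2.symm

/-- The column index of a box, counted from 0, is the number of boxes to its left in its row. Each
unordered pair in a row is counted once this way, hence the factor 2. -/
theorem sum_card_row :
    ∑ x : Box ν, ∑ y : Box ν with y ≠ x, (if x.1.1 = y.1.1 then (1 : ℂ) else 0) =
      2 * ∑ x : Box ν, (x.1.2 : ℂ) := by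
  have h1 : ∀ x : Box ν, ∑ y : Box ν,
      (if x.1.1 = y.1.1 ∧ y.1.2 < x.1.2 then (1 : ℂ) else 0) = x.1.2 := by
    intro x
    rw [Finset.sum_boole]
    congr 1
    rw [← Finset.card_range x.1.2]
    refine Finset.card_bij (fun y _ => y.1.2) ?_ ?_ ?_
    · intro y hy
      simpa using (Finset.mem_filter.1 hy).2.2
    · intro y hy z hz h
      exact Subtype.ext (Prod.ext
        ((Finset.mem_filter.1 hy).2.1.symm.trans (Finset.mem_filter.1 hz).2.1) h)
    · intro j hj
      rw [Finset.mem_range] at hj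
      refine ⟨⟨(x.1.1, j), (diagram ν).up_left_mem le_rfl hj.le x.2⟩, ?_, rfl⟩
      simpa using hj
  have h2 : ∑ x : Box ν, ∑ y : Box ν,
      (if x.1.1 = y.1.1 ∧ x.1.2 < y.1.2 then (1 : ℂ) else 0) = ∑ x : Box ν, (x.1.2 : ℂ) := by
    rw [Finset.sum_comm]
    refine Finset.sum_congr rfl fun x _ => ?_
    rw [← h1]
    simp only [eq_comm]
  have h3 : ∀ x : Box ν, ∑ y : Box ν with y ≠ x, (if x.1.1 = y.1.1 then (1 : ℂ) else 0) =
      ∑ y : Box ν, (if x.1.1 = y.1.1 ∧ y.1.2 < x.1.2 then (1 : ℂ) else 0) +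
      ∑ y : Box ν, (if x.1.1 = y.1.1 ∧ x.1.2 < y.1.2 then (1 : ℂ) else 0) := by
    intro x
    rw [Finset.sum_filter, ← Finset.sum_add_distrib]
    refine Finset.sum_congr rfl fun y _ => ?_
    have hne : y ≠ x ↔ ¬ (x.1.1 = y.1.1 ∧ x.1.2 = y.1.2) := by
      rw [ne_eq, Subtype.ext_iff, Prod.ext_iff, eq_comm, eq_comm (a := y.1.2)]
    simp only [hne]
    by_cases hr : x.1.1 = y.1.1
    · rcases lt_trichotomy x.1.2 y.1.2 with h | h | h
      · simp [hr, h, h.ne, h.le]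
      · simp [hr, h]
      · simp [hr, h, h.ne', h.le]
    · simp [hr]
  simp only [h3, Finset.sum_add_distrib, h1, h2]
  ring

theorem sum_card_col :
    ∑ x : Box ν, ∑ y : Box ν with y ≠ x, (if x.1.2 = y.1.2 then (1 : ℂ) else 0) =
      2 * ∑ x : Box ν, (x.1.1 : ℂ) := by
  have h1 : ∀ x : Box ν, ∑ y : Box ν,
      (if x.1.2 = y.1.2 ∧ y.1.1 < x.1.1 then (1 : ℂ) else 0) = x.1.1 := by
    intro x
    rw [Finset.sum_boole]
    congr 1
    rw [← Finset.card_range x.1.1]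
    refine Finset.card_bij (fun y _ => y.1.1) ?_ ?_ ?_
    · intro y hy
      simpa using (Finset.mem_filter.1 hy).2.2
    · intro y hy z hz h
      exact Subtype.ext (Prod.ext h
        ((Finset.mem_filter.1 hy).2.1.symm.trans (Finset.mem_filter.1 hz).2.1))
    · intro j hj
      rw [Finset.mem_range] at hj
      refine ⟨⟨(j, x.1.2), (diagram ν).up_left_mem hj.le le_rfl x.2⟩, ?_, rfl⟩
      simpa using hj
  have h2 : ∑ x : Box ν, ∑ y : Box ν,
      (if x.1.2 = y.1.2 ∧ x.1.1 < y.1.1 then (1 : ℂ) else 0) = ∑ x : Box ν, (x.1.1 : ℂ) := by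
    rw [Finset.sum_comm]
    refine Finset.sum_congr rfl fun x _ => ?_
    rw [← h1]
    simp only [eq_comm]
  have h3 : ∀ x : Box ν, ∑ y : Box ν with y ≠ x, (if x.1.2 = y.1.2 then (1 : ℂ) else 0) =
      ∑ y : Box ν, (if x.1.2 = y.1.2 ∧ y.1.1 < x.1.1 then (1 : ℂ) else 0) +
      ∑ y : Box ν, (if x.1.2 = y.1.2 ∧ x.1.1 < y.1.1 then (1 : ℂ) else 0) := by
    intro x
    rw [Finset.sum_filter, ← Finset.sum_add_distrib]
    refine Finset.sum_congr rfl fun y _ => ?_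
    have hne : y ≠ x ↔ ¬ (x.1.1 = y.1.1 ∧ x.1.2 = y.1.2) := by
      rw [ne_eq, Subtype.ext_iff, Prod.ext_iff, eq_comm, eq_comm (a := y.1.2)]
    simp only [hne]
    by_cases hr : x.1.2 = y.1.2
    · rcases lt_trichotomy x.1.1 y.1.1 with h | h | h
      · simp [hr, h, h.ne, h.le]
      · simp [hr, h]
      · simp [hr, h, h.ne', h.le]
    · simp [hr]
  simp only [h3, Finset.sum_add_distrib, h1, h2]
  ring

/-- The cells are a first row together with the cells of the tail shifted down by one, so the
induction needs f shifted in its row index. -/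
theorem sum_cellsOfRowLens (w : List ℕ) (f : ℕ → ℕ → ℤ) :
    ∑ c ∈ YoungDiagram.cellsOfRowLens w, f c.1 c.2 =
      ∑ i : Fin w.length, ∑ j ∈ Finset.range w[i], f i j := by
  induction w generalizing f with
  | nil => rfl
  | cons a w ih =>
    rw [YoungDiagram.cellsOfRowLens, Finset.sum_union, Finset.sum_map, Finset.sum_product]
    · have h := ih fun i j => f (i + 1) j
      rw [Finset.sum_singleton]
      simp only [List.length_cons]
      rw [Fin.sum_univ_succ]
      exact congrArg₂ _ rfl h
    · rw [Finset.disjoint_left]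
      rintro ⟨x, y⟩ h1 h2
      simp at h1 h2
      omega

theorem two_mul_sum_range_sub (i n : ℕ) :
    2 * ∑ j ∈ Finset.range n, ((j : ℤ) - i) = (n : ℤ) ^ 2 - 2 * ((i : ℤ) + 1) * n + n := by
  induction n with
  | zero => simp
  | succ n ih =>
    rw [Finset.sum_range_succ, mul_add, ih]
    push_cast
    ring

/-- `κ_ν` is twice the sum of the contents of the boxes. -/
theorem kappa_eq : kappa ν = 2 * ∑ x : Box ν, ((x.1.2 : ℤ) - x.1.1) := by
  have h1 : ∑ x : Box ν, ((x.1.2 : ℤ) - x.1.1) =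
      ∑ c ∈ YoungDiagram.cellsOfRowLens (rows ν), ((c.2 : ℤ) - c.1) :=
    Finset.sum_coe_sort (diagram ν).cells fun c => ((c.2 : ℤ) - c.1)
  have h2 : (d : ℤ) = ∑ i : Fin (rows ν).length, ((rows ν)[i] : ℤ) := by
    have h := Fin.sum_univ_getElem (rows ν)
    rw [rows_sum] at h
    exact_mod_cast h.symm
  rw [h1, sum_cellsOfRowLens _ fun i j => ((j : ℤ) - i), Finset.mul_sum]
  simp only [two_mul_sum_range_sub]
  rw [kappa, Finset.sum_add_distrib, ← h2, add_comm]

/-- Centrality moves the sum between the row and the column symmetrizer. There a pair in one row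
contributes 1, a pair in one column -1, and any other pair 0; the total is twice the sum of the
contents. -/
theorem swapSum_mul_youngSymmetrizer :
    swapSum ν * youngSymmetrizer ν = (kappa ν : ℂ) • youngSymmetrizer ν := by
  have h : ∀ x : Box ν, ∀ y ∈ Finset.univ.filter (fun y : Box ν => y ≠ x),
      rowSymmetrizer ν * MonoidAlgebra.single (swap x y) 1 * colAntisymmetrizer ν =
        ((if x.1.1 = y.1.1 then (1 : ℂ) else 0) - (if x.1.2 = y.1.2 then (1 : ℂ) else 0)) •
          youngSymmetrizer ν := by
    intro x y hy
    have hne : y ≠ x := (Finset.mem_filter.1 hy).2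
    rw [youngSymmetrizer]
    by_cases h1 : x.1.1 = y.1.1
    · have h2 : x.1.2 ≠ y.1.2 := fun h2 => hne (Subtype.ext (Prod.ext h1.symm h2.symm))
      rw [rowSymmetrizer_mul_swap ν h1, if_pos h1, if_neg h2, sub_zero, one_smul]
    · by_cases h2 : x.1.2 = y.1.2
      · rw [mul_assoc, swap_mul_colAntisymmetrizer ν hne.symm h2, if_neg h1, if_pos h2, mul_neg,
          zero_sub, neg_smul, one_smul]
      · rw [rowSymmetrizer_mul_swap_mul_eq_zero ν h1 h2, if_neg h1, if_neg h2, sub_zero, zero_smul]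
  have hk : (kappa ν : ℂ) = ∑ x : Box ν, ∑ y : Box ν with y ≠ x,
      ((if x.1.1 = y.1.1 then (1 : ℂ) else 0) - (if x.1.2 = y.1.2 then (1 : ℂ) else 0)) := by
    simp only [Finset.sum_sub_distrib]
    rw [sum_card_row, sum_card_col, kappa_eq, Finset.sum_sub_distrib]
    push_cast
    ring
  rw [youngSymmetrizer, ← mul_assoc, swapSum_mul_comm, swapSum, hk, Finset.mul_sum,
    Finset.sum_mul, Finset.sum_smul]
  refine Finset.sum_congr rfl fun x _ => ?_
  rw [Finset.mul_sum, Finset.sum_mul, Finset.sum_smul]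
  exact Finset.sum_congr rfl fun y hy => h x y hy

/-- Every element of the module is r c_ν, and the central sum passes r to act on c_ν. -/
theorem sum_spechtRep_swap :
    ∑ x : Box ν, ∑ y : Box ν with y ≠ x, spechtRep ν (swap x y) =
      (kappa ν : ℂ) • (1 : Module.End ℂ (SpechtModule ν)) := by
  ext1 z
  apply Subtype.ext
  obtain ⟨r, hr⟩ := Ideal.mem_span_singleton'.1 z.2
  have h1 : ((∑ x : Box ν, ∑ y : Box ν with y ≠ x, spechtRep ν (swap x y)) z :
      MonoidAlgebra ℂ (SymGroup ν)) = swapSum ν * (z : MonoidAlgebra ℂ (SymGroup ν)) := by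
    simp only [LinearMap.sum_apply, Submodule.coe_sum, swapSum, Finset.sum_mul]
    rfl
  rw [h1, ← hr, ← mul_assoc, swapSum_mul_comm, mul_assoc, swapSum_mul_youngSymmetrizer,
    mul_smul_comm, hr]
  rfl

theorem sum_character_swap_mul (g : SymGroup ν) :
    ∑ x : Box ν, ∑ y : Box ν with y ≠ x, (spechtRep ν).character (swap x y * g) =
      (kappa ν : ℂ) * (spechtRep ν).character g := by
  have h := congrArg (fun A => LinearMap.trace ℂ (SpechtModule ν) (A * spechtRep ν g))
    (sum_spechtRep_swap ν)
  simp only [Finset.sum_mul, map_sum, smul_mul_assoc, one_mul, map_smul, smul_eq_mul] at h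
  simpa only [Representation.character, map_mul] using h

theorem character_eq_of_parts_eq {g h : SymGroup ν} (hgh : g.partition.parts = h.partition.parts) :
    (spechtRep ν).character g = (spechtRep ν).character h := by
  have : IsConj g h := partition_eq_of_isConj.2 (Nat.Partition.ext hgh)
  obtain ⟨c, rfl⟩ := isConj_iff.1 this
  exact ((spechtRep ν).char_conj g c).symm

end Specht

/-! ### The cut-and-join equations -/

/-! ### Sizes of conjugacy classes -/

section CycleCounts

open Equiv.Perm

theorem count_parts (μ : ℕ+ →₀ ℕ) (i : ℕ+) : (parts μ).count (i : ℕ) = μ i := by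
  rw [parts, Multiset.count_map_eq_count' _ _ PNat.coe_injective, Finsupp.count_toMultiset]

theorem toFinset_parts (μ : ℕ+ →₀ ℕ) :
    (parts μ).toFinset = μ.support.map ⟨fun i : ℕ+ => (i : ℕ), PNat.coe_injective⟩ := by
  ext n
  simp [parts]

theorem zee_eq (μ : ℕ+ →₀ ℕ) :
    zee μ = (parts μ).prod * ∏ n ∈ (parts μ).toFinset, ((parts μ).count n).factorial := by
  rw [Finset.prod_multiset_count, ← Finset.prod_mul_distrib, toFinset_parts, Finset.prod_map, zee,
    Finsupp.prod]
  refine Finset.prod_congr rfl fun i _ => ?_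
  simp only [Function.Embedding.coeFn_mk, count_parts]
  ring

theorem zee_ne_zero (μ : ℕ+ →₀ ℕ) : zee μ ≠ 0 :=
  Finset.prod_ne_zero_iff.2 fun i _ =>
    mul_ne_zero (Nat.factorial_ne_zero _) (pow_ne_zero _ i.ne_zero)

/-- The number of permutations of cycle type `μ` is `d! / z_μ`. -/
theorem card_parts_eq_mul_zee {α : Type*} [Fintype α] [DecidableEq α] (μ : ℕ+ →₀ ℕ)
    (h : size μ = Fintype.card α) :
    (Finset.univ.filter fun g : Equiv.Perm α => g.partition.parts = parts μ).card * zee μ =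
      (Fintype.card α).factorial := by
  -- `cycleType` omits fixed points, so the parts equal to 1 are split off; their number k gives the
  -- factor (d - `m.sum`)! of the count.
  set m := (parts μ).filter fun n => 2 ≤ n
  set k := ((parts μ).filter fun n => ¬ 2 ≤ n).card
  have h1 : (parts μ).filter (fun n => ¬ 2 ≤ n) = Multiset.replicate k 1 := by
    rw [Multiset.eq_replicate_card]
    intro b hb
    rw [Multiset.mem_filter] at hb
    have := parts_pos μ hb.1
    omega
  have h2 : parts μ = m + Multiset.replicate k 1 := by
    rw [← h1]
    exact (Multiset.filter_add_not _ _).symm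
  have hsum : m.sum + k = Fintype.card α := by
    rw [← h, ← parts_sum, h2]
    simp
  have hset : (Finset.univ.filter fun g : Equiv.Perm α => g.partition.parts = parts μ) =
      Finset.univ.filter fun g : Equiv.Perm α => g.cycleType = m := by
    ext g
    simp only [Finset.mem_filter, Finset.mem_univ, true_and]
    constructor
    · intro hg
      rw [← filter_parts_partition_eq_cycleType, hg]
    · intro hg
      rw [parts_partition, hg, h2, ← sum_cycleType, hg]
      congr 2
      omega
  have hm2 : ∀ n ∈ m, 2 ≤ n := fun n hn => (Multiset.mem_filter.1 hn).2
  have hcard := card_of_cycleType_mul_eq α m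
  rw [if_pos ⟨by omega, hm2⟩] at hcard
  have hone : 1 ∉ m := fun h => by
    have := hm2 1 h
    omega
  have hz : zee μ = (Fintype.card α - m.sum).factorial * m.prod *
      ∏ n ∈ m.toFinset, (m.count n).factorial := by
    have e1 : (parts μ).prod = m.prod := by
      rw [h2]
      simp
    have e2 : ∏ n ∈ (parts μ).toFinset, ((parts μ).count n).factorial =
        ∏ n ∈ insert 1 m.toFinset, ((parts μ).count n).factorial := by
      refine Finset.prod_subset ?_ ?_
      · intro n hn
        rw [Multiset.mem_toFinset, h2, Multiset.mem_add] at hn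
        rw [Finset.mem_insert, Multiset.mem_toFinset]
        exact hn.symm.imp_left Multiset.eq_of_mem_replicate
      · intro n _ hn
        rw [Multiset.mem_toFinset] at hn
        rw [Multiset.count_eq_zero_of_notMem hn, Nat.factorial_zero]
    have e3 : (parts μ).count 1 = Fintype.card α - m.sum := by
      rw [h2, Multiset.count_add, Multiset.count_eq_zero_of_notMem hone,
        Multiset.count_replicate_self]
      omega
    rw [zee_eq, e1, e2, Finset.prod_insert (by rwa [Multiset.mem_toFinset]), e3]
    have e4 : ∏ n ∈ m.toFinset, ((parts μ).count n).factorial =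
        ∏ n ∈ m.toFinset, (m.count n).factorial := by
      refine Finset.prod_congr rfl fun n hn => ?_
      have hn1 : n ≠ 1 := by
        rintro rfl
        exact hone (Multiset.mem_toFinset.1 hn)
      rw [h2, Multiset.count_add, Multiset.count_replicate, if_neg hn1.symm, add_zero]
    rw [e4]
    ring
  rw [hset, hz, hcard]

end CycleCounts

/-- The multiplicities of the cycle lengths of a permutation. -/
noncomputable def cycleExponent {α : Type*} [Fintype α] [DecidableEq α] (g : Equiv.Perm α) :
    ℕ+ →₀ ℕ :=
  (exists_parts_eq g.partition.parts fun _ h => g.partition.parts_pos h).choose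

theorem parts_cycleExponent {α : Type*} [Fintype α] [DecidableEq α] (g : Equiv.Perm α) :
    parts (cycleExponent g) = g.partition.parts :=
  (exists_parts_eq g.partition.parts fun _ h => g.partition.parts_pos h).choose_spec

/-- The Frobenius characteristic of `χ_ν`, in power sums. -/
noncomputable def frobenius {d : ℕ} (ν : Nat.Partition d) : MvPowerSeries ℕ+ ℂ :=
  ∑ g : SymGroup ν, ((spechtRep ν).character g / (d.factorial : ℂ)) • monomial (cycleExponent g) 1

theorem coeff_frobenius {d : ℕ} (ν : Nat.Partition d) (μ : ℕ+ →₀ ℕ) :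
    coeff μ (frobenius ν) = ∑ g : SymGroup ν, (spechtRep ν).character g / (d.factorial : ℂ) *
      (if g.partition.parts = parts μ then 1 else 0) := by
  classical
  rw [frobenius, map_sum]
  refine Finset.sum_congr rfl fun g _ => ?_
  rw [coeff_smul, coeff_monomial]
  congr 1
  simp only [← parts_cycleExponent g, parts_injective.eq_iff, eq_comm]

/-- The class of μ has d!/z_μ elements and the character is constant on it. -/
theorem chi_div_zee (μ : ℕ+ →₀ ℕ) (ν : Nat.Partition (size μ)) :
    chi μ ν / (zee μ : ℂ) = coeff μ (frobenius ν) := by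
  have hc := card_parts_eq_mul_zee (α := Box ν) μ (card_box ν).symm
  have hz : (zee μ : ℂ) ≠ 0 := by exact_mod_cast zee_ne_zero μ
  have hd : (((size μ).factorial : ℕ) : ℂ) ≠ 0 := by exact_mod_cast Nat.factorial_ne_zero _
  have h : ∀ g : SymGroup ν, (spechtRep ν).character g / ((size μ).factorial : ℂ) *
      (if g.partition.parts = parts μ then 1 else 0) =
      if g.partition.parts = parts μ then chi μ ν / ((size μ).factorial : ℂ) else 0 := by
    intro g
    split_ifs with hg
    · rw [mul_one, chi, character_eq_of_parts_eq ν (hg.trans (exists_cycleType μ ν).choose_spec.symm)]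
    · rw [mul_zero]
  rw [coeff_frobenius]
  simp only [h]
  rw [← Finset.sum_filter, Finset.sum_const, nsmul_eq_mul]
  have hc' : ((Finset.univ.filter fun g : SymGroup ν =>
      g.partition.parts = parts μ).card : ℂ) * (zee μ : ℂ) = ((size μ).factorial : ℂ) := by
    conv_rhs => rw [← card_box ν]
    exact_mod_cast hc
  rw [← hc'] at hd ⊢
  have := left_ne_zero_of_mul hd
  field_simp

theorem cutJoin_sum_smul {ι : Type*} (s : Finset ι) (c : ι → ℂ) (F : ι → MvPowerSeries ℕ+ ℂ)
    (i j : ℕ+) : cutJoin i j (∑ k ∈ s, c k • F k) = ∑ k ∈ s, c k • cutJoin i j (F k) := by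
  simp only [cutJoin, D, map_sum, Derivation.map_smul, Finset.mul_sum, mul_smul_comm,
    smul_add, Finset.sum_add_distrib]

/-- The Frobenius characteristic of `χ_ν` is an eigenvector of the cut-and-join operator, for the
eigenvalue `κ_ν`. -/
theorem finsum_coeff_cutJoin_frobenius {d : ℕ} (ν : Nat.Partition d) (μ : ℕ+ →₀ ℕ) :
    (Function.support fun ij : ℕ+ × ℕ+ =>
      coeff μ (cutJoin ij.1 ij.2 (frobenius ν))).Finite ∧
    ∑ᶠ ij : ℕ+ × ℕ+, coeff μ (cutJoin ij.1 ij.2 (frobenius ν)) =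
      (kappa ν : ℂ) * coeff μ (frobenius ν) := by
  classical
  let f : Multiset ℕ → ℂ := fun M => if M = parts μ then 1 else 0
  have hf : ∀ τ, f (parts τ) = if μ = τ then 1 else 0 := by
    intro τ
    simp only [f, parts_injective.eq_iff, eq_comm]
  let c : SymGroup ν → ℂ := fun g => (spechtRep ν).character g / (d.factorial : ℂ)
  have h1 : (fun ij : ℕ+ × ℕ+ => coeff μ (cutJoin ij.1 ij.2 (frobenius ν))) = fun ij =>
      ∑ g : SymGroup ν, c g * coeff μ (cutJoin ij.1 ij.2 (monomial (cycleExponent g) 1)) := by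
    funext ij
    rw [frobenius, cutJoin_sum_smul, map_sum]
    simp only [coeff_smul, c]
  have hfin : ∀ g ∈ (Finset.univ : Finset (SymGroup ν)), (Function.support fun ij : ℕ+ × ℕ+ =>
      c g * coeff μ (cutJoin ij.1 ij.2 (monomial (cycleExponent g) 1))).Finite := fun g _ =>
    (finsum_coeff_cutJoin_monomial μ (cycleExponent g) f hf).1.subset fun ij h =>
      right_ne_zero_of_mul h
  rw [h1]
  constructor
  · refine ((Finset.univ : Finset (SymGroup ν)).finite_toSet.biUnion hfin).subset fun ij h => ?_
    obtain ⟨g, hg, hne⟩ := Finset.exists_ne_zero_of_sum_ne_zero h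
    exact Set.mem_biUnion hg hne
  · rw [finsum_sum_comm _ _ hfin]
    have h2 : ∀ g : SymGroup ν, ∑ᶠ ij : ℕ+ × ℕ+,
        c g * coeff μ (cutJoin ij.1 ij.2 (monomial (cycleExponent g) 1)) =
        ∑ x : Box ν, ∑ y : Box ν with y ≠ x,
          c g * f (Equiv.swap x y * g).partition.parts := by
      intro g
      rw [← mul_finsum, (finsum_coeff_cutJoin_monomial μ (cycleExponent g) f hf).2,
        parts_cycleExponent, ← sum_swap_mul f g]
      simp only [Finset.mul_sum]
    rw [Finset.sum_congr rfl fun g _ => h2 g, Finset.sum_comm]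
    -- Substituting (x y)g for g moves the transposition from the monomial to the character, where
    -- `sum_character_swap_mul` evaluates the sum.
    have h3 : ∀ x : Box ν, ∑ g : SymGroup ν, ∑ y : Box ν with y ≠ x,
          c g * f (Equiv.swap x y * g).partition.parts =
        ∑ g : SymGroup ν, ∑ y : Box ν with y ≠ x,
          c (Equiv.swap x y * g) * f g.partition.parts := by
      intro x
      rw [Finset.sum_comm, Finset.sum_comm (s := (Finset.univ : Finset (SymGroup ν)))]
      refine Finset.sum_congr rfl fun y _ => ?_
      refine Fintype.sum_equiv (Equiv.mulLeft (Equiv.swap x y)) _ _ fun g => ?_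
      simp [← mul_assoc]
    rw [Finset.sum_congr rfl fun x _ => h3 x, Finset.sum_comm, coeff_frobenius, Finset.mul_sum]
    refine Finset.sum_congr rfl fun g _ => ?_
    simp only [← Finset.sum_mul]
    rw [← mul_assoc, mul_div_assoc', ← sum_character_swap_mul, Finset.sum_div]
    simp only [Finset.sum_div, c]
    rfl

/-- The factor of `χ_ν(C(μ)) / z_μ` in the coefficients of `R^•`. -/
noncomputable def shapeFactor (lam t : ℂ) {d : ℕ} (ν : Nat.Partition d) : ℂ :=
  Complex.exp (Complex.I * (t + 1 / 2) * (kappa ν : ℂ) * lam / 2) * V ν lam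

/-- With d independent of μ, a single series carries the weights of all partitions of d, which is
all that a homogeneous operator sees in that degree. -/
theorem weight_eq (lam t : ℂ) {d : ℕ} {μ : ℕ+ →₀ ℕ} (h : size μ = d) :
    weight lam t μ = coeff μ (∑ ν : Nat.Partition d, shapeFactor lam t ν • frobenius ν) := by
  subst h
  rw [weight, map_sum]
  refine Finset.sum_congr rfl fun ν _ => ?_
  rw [chi_div_zee, coeff_smul, shapeFactor]
  ring

theorem hasDerivAt_shapeFactor (lam t : ℂ) {d : ℕ} (ν : Nat.Partition d) :
    HasDerivAt (fun s => shapeFactor lam s ν)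
      (Complex.I * lam / 2 * (kappa ν * shapeFactor lam t ν)) t := by
  have h1 : HasDerivAt (fun s : ℂ => Complex.I * (s + 1 / 2) * (kappa ν : ℂ) * lam / 2)
      (Complex.I * 1 * (kappa ν : ℂ) * lam / 2) t :=
    ((((((hasDerivAt_id t).add_const (1 / 2 : ℂ)).const_mul Complex.I).mul_const
      (kappa ν : ℂ)).mul_const lam).div_const 2)
  refine (h1.cexp.mul_const (V ν lam)).congr_deriv ?_
  rw [shapeFactor]
  ring

/-- The result of the linear cut-and-join operator on `R^•`. -/
noncomputable def cutJoinRBullet (lam t : ℂ) : MvPowerSeries ℕ+ ℂ := fun μ =>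
  ∑ ν : Nat.Partition (size μ), kappa ν * shapeFactor lam t ν * coeff μ (frobenius ν)

/-- By homogeneity, `RBullet` may be replaced by its part of degree `size μ`, a finite combination
of eigenvectors. -/
theorem hasFormalSum_cutJoin_RBullet (lam t : ℂ) :
    HasFormalSum (fun ij : ℕ+ × ℕ+ => cutJoin ij.1 ij.2 (RBullet lam t))
      (cutJoinRBullet lam t) := by
  intro μ
  have h1 : (fun ij : ℕ+ × ℕ+ => coeff μ (cutJoin ij.1 ij.2 (RBullet lam t))) = fun ij =>
      ∑ ν : Nat.Partition (size μ),
        shapeFactor lam t ν * coeff μ (cutJoin ij.1 ij.2 (frobenius ν)) := by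
    funext ij
    rw [coeff_cutJoin_congr (F := RBullet lam t) fun τ hτ => weight_eq lam t hτ,
      cutJoin_sum_smul, map_sum]
    simp only [coeff_smul]
  have hfin : ∀ ν ∈ (Finset.univ : Finset (Nat.Partition (size μ))),
      (Function.support fun ij : ℕ+ × ℕ+ =>
        shapeFactor lam t ν * coeff μ (cutJoin ij.1 ij.2 (frobenius ν))).Finite := fun ν _ =>
    (finsum_coeff_cutJoin_frobenius ν μ).1.subset fun ij h => right_ne_zero_of_mul h
  rw [h1]
  constructor
  · refine (Finset.univ.finite_toSet.biUnion hfin).subset fun ij h => ?_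
    obtain ⟨ν, hν, hne⟩ := Finset.exists_ne_zero_of_sum_ne_zero h
    exact Set.mem_biUnion hν hne
  · rw [finsum_sum_comm _ _ hfin]
    change ∑ ν : Nat.Partition (size μ), _ = _
    refine Finset.sum_congr rfl fun ν _ => ?_
    rw [← mul_finsum, (finsum_coeff_cutJoin_frobenius ν μ).2]
    ring

theorem hasParamDerivAt_RBullet (lam t : ℂ) :
    HasParamDerivAt (fun s => RBullet lam s) (C (Complex.I * lam / 2) * cutJoinRBullet lam t) t := by
  intro μ
  have h1 : (fun s => coeff μ (RBullet lam s)) = fun s =>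
      ∑ ν : Nat.Partition (size μ), shapeFactor lam s ν * coeff μ (frobenius ν) := by
    funext s
    change weight lam s μ = _
    rw [weight_eq lam s rfl, map_sum]
    simp only [coeff_smul]
  have h2 : coeff μ (C (Complex.I * lam / 2) * cutJoinRBullet lam t) =
      ∑ ν : Nat.Partition (size μ),
        Complex.I * lam / 2 * (kappa ν * shapeFactor lam t ν) * coeff μ (frobenius ν) := by
    rw [coeff_C_mul]
    change _ * ∑ ν : Nat.Partition (size μ), _ = _
    rw [Finset.mul_sum]
    exact Finset.sum_congr rfl fun ν _ => by ring
  rw [h1, h2]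
  exact HasDerivAt.fun_sum fun ν _ => (hasDerivAt_shapeFactor lam t ν).mul_const _

/-! ### The empty partition -/

/-- Without boxes the group is trivial and both symmetrizers are 1, so the ideal is the whole
one-dimensional algebra. -/
theorem character_one_of_isEmpty (ν : Nat.Partition 0) : (spechtRep ν).character 1 = 1 := by
  classical
  have hE : IsEmpty (Box ν) := Fintype.card_eq_zero_iff.1 (card_box ν)
  have h1 : rowSymmetrizer ν = 1 := by
    have hs : (Finset.univ.filter fun g : SymGroup ν => PreservesRows ν g) = {1} := by
      ext g
      simp only [Finset.mem_filter, Finset.mem_univ, true_and, Finset.mem_singleton]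
      exact ⟨fun _ => Subsingleton.elim _ _, fun _ c => hE.elim c⟩
    rw [rowSymmetrizer]
    convert Finset.sum_singleton (fun g : SymGroup ν => MonoidAlgebra.single g (1 : ℂ)) 1
    rw [MonoidAlgebra.one_def]
  have h2 : colAntisymmetrizer ν = 1 := by
    have hs : (Finset.univ.filter fun g : SymGroup ν => PreservesCols ν g) = {1} := by
      ext g
      simp only [Finset.mem_filter, Finset.mem_univ, true_and, Finset.mem_singleton]
      exact ⟨fun _ => Subsingleton.elim _ _, fun _ c => hE.elim c⟩
    rw [colAntisymmetrizer]
    convert Finset.sum_singleton (fun g : SymGroup ν =>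
      MonoidAlgebra.single g (((Equiv.Perm.sign g : ℤˣ) : ℤ) : ℂ)) 1
    simp [MonoidAlgebra.one_def]
  have h3 : (1 : MonoidAlgebra ℂ (SymGroup ν)) ∈ SpechtModule ν := by
    rw [SpechtModule, youngSymmetrizer, h1, h2, mul_one]
    exact Ideal.mem_span_singleton_self _
  have h4 : ∀ z : MonoidAlgebra ℂ (SymGroup ν), ∃ c : ℂ, c • 1 = z := by
    intro z
    induction z using MonoidAlgebra.induction_linear with
    | zero => exact ⟨0, zero_smul _ _⟩
    | add f g hf hg =>
      obtain ⟨a, rfl⟩ := hf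
      obtain ⟨b, rfl⟩ := hg
      exact ⟨a + b, add_smul _ _ _⟩
    | single g r =>
      refine ⟨r, ?_⟩
      rw [Subsingleton.elim g 1, MonoidAlgebra.one_def]
      simp
  rw [Representation.char_one]
  have h5 : Module.finrank ℂ (SpechtModule ν) = 1 := by
    refine (finrank_eq_one_iff_of_nonzero' (⟨1, h3⟩ : SpechtModule ν) fun h => ?_).2 fun w => ?_
    · exact one_ne_zero (congrArg Subtype.val h)
    · obtain ⟨c, hc⟩ := h4 w
      exact ⟨c, Subtype.ext hc⟩
  rw [h5, Nat.cast_one]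

theorem weight_zero (lam t : ℂ) : weight lam t 0 = 1 := by
  have hs : size 0 = 0 := by simp [size]
  rw [weight_eq lam t hs, map_sum, Fintype.sum_unique]
  set ν : Nat.Partition 0 := default
  have hr : rows ν = [] := by
    have h : ν.parts = 0 := by simp [ν]
    rw [rows, h, Multiset.sort_zero]
  have hE : IsEmpty (Fin (rows ν).length) := by
    rw [hr]
    exact Fin.isEmpty
  have hk : kappa ν = 0 := by simp [kappa]
  have hV : V ν lam = 1 := by simp [V]
  have hB : IsEmpty (Box ν) := Fintype.card_eq_zero_iff.1 (card_box ν)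
  have hp : ∀ g : SymGroup ν, g.partition.parts = parts 0 := fun g => by
    have h0 : g = 1 := Subsingleton.elim _ _
    rw [h0, Equiv.Perm.parts_partition, card_box]
    simp [parts]
  rw [coeff_smul, coeff_frobenius, Fintype.sum_unique, if_pos (hp _),
    Subsingleton.elim (default : SymGroup ν) 1, character_one_of_isEmpty, shapeFactor, hk, hV]
  simp

end CutJoin

theorem theorem1 (lam : ℂ) (hlam : ∀ k : ℕ, 1 ≤ k → Complex.sin ((k : ℂ) * lam / 2) ≠ 0)
    (tau : ℂ) :
    -- `R^• = exp R`
    CutJoin.HasFormalSum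
      (fun n : ℕ => MvPowerSeries.C ((n.factorial : ℂ)⁻¹) * CutJoin.R lam tau ^ n)
      (CutJoin.RBullet lam tau) ∧
    -- the nonlinear cut-and-join equation for `R`
    (∃ S : MvPowerSeries ℕ+ ℂ,
      CutJoin.HasFormalSum
        (fun ij : ℕ+ × ℕ+ =>
          CutJoin.nat (ij.1 * ij.2) * CutJoin.p (ij.1 + ij.2) *
              CutJoin.D ij.1 (CutJoin.D ij.2 (CutJoin.R lam tau)) +
            CutJoin.nat (ij.1 * ij.2) * CutJoin.p (ij.1 + ij.2) *
              (CutJoin.D ij.1 (CutJoin.R lam tau) * CutJoin.D ij.2 (CutJoin.R lam tau)) +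
            CutJoin.nat (ij.1 + ij.2) * CutJoin.p ij.1 * CutJoin.p ij.2 *
              CutJoin.D (ij.1 + ij.2) (CutJoin.R lam tau)) S ∧
      CutJoin.HasParamDerivAt (fun t => CutJoin.R lam t)
        (MvPowerSeries.C (Complex.I * lam / 2) * S) tau) ∧
    -- the linear cut-and-join equation for `R^•`
    (∃ S : MvPowerSeries ℕ+ ℂ,
      CutJoin.HasFormalSum
        (fun ij : ℕ+ × ℕ+ =>
          CutJoin.nat (ij.1 * ij.2) * CutJoin.p (ij.1 + ij.2) *
              CutJoin.D ij.1 (CutJoin.D ij.2 (CutJoin.RBullet lam tau)) +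
            CutJoin.nat (ij.1 + ij.2) * CutJoin.p ij.1 * CutJoin.p ij.2 *
              CutJoin.D (ij.1 + ij.2) (CutJoin.RBullet lam tau)) S ∧
      CutJoin.HasParamDerivAt (fun t => CutJoin.RBullet lam t)
        (MvPowerSeries.C (Complex.I * lam / 2) * S) tau) := by
  have hlog : ∀ t, CutJoin.IsLog (CutJoin.R lam t) (CutJoin.RBullet lam t) := fun t =>
    CutJoin.isLog_R lam t (CutJoin.weight_zero lam t)
  have hc : MvPowerSeries.constantCoeff (CutJoin.RBullet lam tau) = 1 :=
    CutJoin.weight_zero lam tau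
  have hsum := CutJoin.hasFormalSum_cutJoin_RBullet lam tau
  have hderiv := CutJoin.hasParamDerivAt_RBullet lam tau
  refine ⟨(hlog tau).hasFormalSum_exp hc,
    ⟨(CutJoin.RBullet lam tau)⁻¹ * CutJoin.cutJoinRBullet lam tau,
      (hsum.const_mul _).congr fun ij => (hlog tau).inv_mul_cutJoin hc ij.1 ij.2, ?_⟩,
    ⟨CutJoin.cutJoinRBullet lam tau, hsum, hderiv⟩⟩
  -- The constant is moved inside, so that the derivative reads F⁻¹ times the derivative of F, with
  -- F = `RBullet`.
  rw [mul_left_comm]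
  exact CutJoin.IsLog.hasParamDerivAt hlog hc hderiv
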